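/- **Setting.** Composites are written in diagrammatic order. *Gray-category.* A Gray-category $\mathbb K$ is a category enriched in strict 2-categories with the Gray tensor product. Explicitly: a category (0-cells, 1-cells) in which every hom-set $\mathbb K(X,Y)$ is the set of objects of a strict 2-category (its 1-morphisms are the 2-cells of $\mathbb K$, its 2-morphisms the 3-cells), with whiskering by 1-cells $f\circ-$ and $-\circ g$, which are strict 2-functors and are strictly unital and associative, and with, for $\alpha\colon f\Rightarrow f'$ in $\mathbb K(X,Y)$ and $\beta\colon g\Rightarrow g'$ in $\mathbb K(Y,Z)$, an invertible 3-cell (the interchange isomorphism) $$\gamma_{\alpha,\beta}\colon (\alpha\circ g)\cdot(f'\circ\beta)\Rrightarrow (f\circ\beta)\cdot(\alpha\circ g'),$$ which is natural in $\alpha$ and $\beta$, compatible with identities and with composition in each variable, and compatible with whiskering by 1-cells. *Pasting scheme.* A pasting scheme $\mathcal G$ is a finite directed acyclic multigraph embedded in the oriented plane, with distinct vertices $s,t$ on the exterior face, such that for every vertex $v$ there are directed paths from $s$ to $v$ and from $v$ to $t$. Every interior face $F$ then has a boundary of the form $\sigma_F\tau_F^{*}$ with directed paths $\sigma_F,\tau_F\colon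 s_F\to t_F$, where the edges of the uppermost path $\sigma_F$ have $F$ on their right, and those of the lowermost path $\tau_F$ have $F$ on their left; the exterior face is bounded by a top path and a bottom path from $s$ to $t$. Write $F\lhd H$ if $\tau_F$ and $\sigma_H$ share an edge. *The groupoid $\mathcal C_{\mathcal G}$.* Its objects are the possible orders of composition: the lists $F_1F_2\cdots F_n$ of all interior faces, each occurring once, in which $F$ precedes $H$ whenever $F\lhd H$. Its morphisms are generated by $\overline U\,\widehat{FH}\,\overline V\colon \overline U FH\overline V\to\overline U HF\overline V$ (one for every pair of objects of this form), subject to the relations: $\overline U\,\widehat{HF}\,\overline V$ is inverse to $\overline U\,\widehat{FH}\,\overline V$; exchanges at disjoint places commute; and the two ways $ABC\to BAC\to BCA\to CBA$ and $ABC\to ACB\to CAB\to CBA$ of reversing three consecutive faces agree. *Labelling.* A labelling $\mathcal L$ of $\mathcal G$ in $\mathbb K$ assigns a 0-cell to every vertex, a 1-cell to every edge and to every interior face $F$ a 2-cell $\mathcal L(F)\colon\mathcal L(\sigma_F)\Rightarrow\mathcal L(\tau_F)$, preserving sources and targets; here $\mathcal L(\pi)$ denotes the composite 1-cell along a directed path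 $\pi$. Put $S=\mathcal L(s)$, $T=\mathcal L(t)$, and let $p,q\colon S\to T$ be the composites along the top and the bottom path. If $\pi=\pi_1\sigma_F\pi_2$ and $\rho=\pi_1\tau_F\pi_2$ are directed paths, then $\overline{\mathcal L(F)}=\mathcal L(\pi_1)\circ\mathcal L(F)\circ\mathcal L(\pi_2)\colon\mathcal L(\pi)\Rightarrow\mathcal L(\rho)$ is the label of $F$ whiskered by 1-cells. Starting from the top path, the faces of an object $F_1\cdots F_n$ of $\mathcal C_{\mathcal G}$ can be applied in this order, ending with the bottom path. The labelling induces a functor $$\mathcal L\colon\mathcal C_{\mathcal G}\to\mathbb K(S,T)[p,q],\qquad \mathcal L(F_1\cdots F_n)=\overline{\mathcal L(F_1)}\cdots\overline{\mathcal L(F_n)}\colon p\Rightarrow q,$$ into the category of 2-cells $p\Rightarrow q$ and 3-cells between them, which sends $\overline U\,\widehat{FH}\,\overline V$ to the interchange isomorphism of the whiskered labels of $F$ and $H$ (to its inverse if $H$ lies before $F$ along the path), whiskered by the composites of the labels of the faces in $\overline U$ and in $\overline V$. Its values on morphisms are the pasting comparison isomorphisms. **Theorem.** Let $\mathcal L$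 be a labelling of a pasting scheme $\mathcal G$ in a Gray-category $\mathbb K$, let $F$ be an interior face, $\alpha=\mathcal L(F)$, let $\alpha'\colon\mathcal L(\sigma_F)\Rightarrow\mathcal L(\tau_F)$ be a 2-cell and $\Gamma\colon\alpha\Rrightarrow\alpha'$ a 3-cell. Let $\mathcal L^{\alpha'}$ be the labelling which has $\alpha'$ in the face $F$ and coincides with $\mathcal L$ everywhere else. Then there is a natural transformation $$\Gamma^{\ast}\colon\mathcal L\Rightarrow\mathcal L^{\alpha'}\colon\mathcal C_{\mathcal G}\to\mathbb K(S,T)[p,q]$$ whose component at an object $\overline H F\overline K$ of $\mathcal C_{\mathcal G}$ is the 3-cell $$\overline{\mathcal L(\overline H)}\cdot\overline{\Gamma}\cdot\overline{\mathcal L(\overline K)}\colon\mathcal L(\overline HF\overline K)\Rrightarrow\mathcal L^{\alpha'}(\overline HF\overline K),$$ where $\overline{\mathcal L(\overline H)}\colon p\Rightarrow\mathcal L(\pi)$ and $\overline{\mathcal L(\overline K)}\colon\mathcal L(\rho)\Rightarrow q$ are the composites of the whiskered labels of the faces in $\overline H$ and in $\overline K$, in these orders, $\pi=\pi_1\sigma_F\pi_2$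 is the path reached after the faces in $\overline H$, $\rho=\pi_1\tau_F\pi_2$, and $\overline\Gamma=\mathcal L(\pi_1)\circ\Gamma\circ\mathcal L(\pi_2)$. In particular $\mathcal L(\varphi)\cdot\Gamma^{\ast}_y=\Gamma^{\ast}_x\cdot\mathcal L^{\alpha'}(\varphi)$ for every $\varphi\colon x\to y$ in $\mathcal C_{\mathcal G}$, so that applying $\Gamma$ commutes with the pasting comparison isomorphisms. -/

import Mathlib

open CategoryTheory Bicategory

universe u v w₂ w₃

attribute [-instance] catToReflQuiver

/-- A Gray-category, unpacked: a category of 0-cells and 1-cells whose hom-sets are the objects of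
strict 2-categories, together with a composition `K(X,Y) ⊗ K(Y,Z) ⟶ K(X,Z)` out of the Gray tensor
product, that is, a cubical functor of two variables which is strictly associative and unital.
Inside `X ⟶ Y`, the objects are the 1-cells of `K`, the 1-morphisms are its 2-cells and the
2-morphisms are its 3-cells.  Composites are written in diagrammatic order.  Equations between
cells whose boundaries are only provably equal are stated with `≍`. -/
class GrayCategory (K : Type u) extends Category.{v} K where
  [homBicategory : ∀ X Y : K, Bicategory.{w₃, w₂} (X ⟶ Y)]
  [homStrict : ∀ X Y : K, Bicategory.Strict (X ⟶ Y)]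
  /-- Whiskering of a 2-cell by a 1-cell on the source side. -/
  wl {X Y Z : K} (f : X ⟶ Y) {g g' : Y ⟶ Z} (β : g ⟶ g') : (f ≫ g) ⟶ (f ≫ g')
  /-- Whiskering of a 3-cell by a 1-cell on the source side. -/
  wl₃ {X Y Z : K} (f : X ⟶ Y) {g g' : Y ⟶ Z} {β β' : g ⟶ g'} (Θ : β ⟶ β') : wl f β ⟶ wl f β'
  /-- Whiskering of a 2-cell by a 1-cell on the target side. -/
  wr {X Y Z : K} {f f' : X ⟶ Y} (α : f ⟶ f') (g : Y ⟶ Z) : (f ≫ g) ⟶ (f' ≫ g)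
  /-- Whiskering of a 3-cell by a 1-cell on the target side. -/
  wr₃ {X Y Z : K} {f f' : X ⟶ Y} {α α' : f ⟶ f'} (Γ : α ⟶ α') (g : Y ⟶ Z) : wr α g ⟶ wr α' g
  /-- The interchange isomorphism. -/
  γ {X Y Z : K} {f f' : X ⟶ Y} (α : f ⟶ f') {g g' : Y ⟶ Z} (β : g ⟶ g') :
    wr α g ≫ wl f' β ≅ wl f β ≫ wr α g'
  -- `f ≫ -` is a strict 2-functor
  wl_id {X Y Z : K} (f : X ⟶ Y) (g : Y ⟶ Z) : wl f (𝟙 g) = 𝟙 (f ≫ g)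
  wl_comp {X Y Z : K} (f : X ⟶ Y) {g g' g'' : Y ⟶ Z} (β : g ⟶ g') (β' : g' ⟶ g'') :
    wl f (β ≫ β') = wl f β ≫ wl f β'
  wl₃_id {X Y Z : K} (f : X ⟶ Y) {g g' : Y ⟶ Z} (β : g ⟶ g') : wl₃ f (𝟙 β) = 𝟙 (wl f β)
  wl₃_comp {X Y Z : K} (f : X ⟶ Y) {g g' : Y ⟶ Z} {β β' β'' : g ⟶ g'} (Θ : β ⟶ β')
    (Θ' : β' ⟶ β'') : wl₃ f (Θ ≫ Θ') = wl₃ f Θ ≫ wl₃ f Θ'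
  wl₃_whiskerLeft {X Y Z : K} (f : X ⟶ Y) {g g' g'' : Y ⟶ Z} (β : g ⟶ g') {δ δ' : g' ⟶ g''}
    (Θ : δ ⟶ δ') : wl₃ f (β ◁ Θ) ≍ wl f β ◁ wl₃ f Θ
  wl₃_whiskerRight {X Y Z : K} (f : X ⟶ Y) {g g' g'' : Y ⟶ Z} {β β' : g ⟶ g'} (Θ : β ⟶ β')
    (δ : g' ⟶ g'') : wl₃ f (Θ ▷ δ) ≍ wl₃ f Θ ▷ wl f δ
  -- `- ≫ g` is a strict 2-functor
  wr_id {X Y Z : K} (f : X ⟶ Y) (g : Y ⟶ Z) : wr (𝟙 f) g = 𝟙 (f ≫ g)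
  wr_comp {X Y Z : K} {f f' f'' : X ⟶ Y} (α : f ⟶ f') (α' : f' ⟶ f'') (g : Y ⟶ Z) :
    wr (α ≫ α') g = wr α g ≫ wr α' g
  wr₃_id {X Y Z : K} {f f' : X ⟶ Y} (α : f ⟶ f') (g : Y ⟶ Z) : wr₃ (𝟙 α) g = 𝟙 (wr α g)
  wr₃_comp {X Y Z : K} {f f' : X ⟶ Y} {α α' α'' : f ⟶ f'} (Γ : α ⟶ α') (Γ' : α' ⟶ α'')
    (g : Y ⟶ Z) : wr₃ (Γ ≫ Γ') g = wr₃ Γ g ≫ wr₃ Γ' g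
  wr₃_whiskerLeft {X Y Z : K} {f f' f'' : X ⟶ Y} (α : f ⟶ f') {δ δ' : f' ⟶ f''} (Γ : δ ⟶ δ')
    (g : Y ⟶ Z) : wr₃ (α ◁ Γ) g ≍ wr α g ◁ wr₃ Γ g
  wr₃_whiskerRight {X Y Z : K} {f f' f'' : X ⟶ Y} {α α' : f ⟶ f'} (Γ : α ⟶ α') (δ : f' ⟶ f'')
    (g : Y ⟶ Z) : wr₃ (Γ ▷ δ) g ≍ wr₃ Γ g ▷ wr δ g
  -- unit laws
  id_wl {X Y : K} {f f' : X ⟶ Y} (α : f ⟶ f') : wl (𝟙 X) α ≍ α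
  id_wl₃ {X Y : K} {f f' : X ⟶ Y} {α α' : f ⟶ f'} (Γ : α ⟶ α') : wl₃ (𝟙 X) Γ ≍ Γ
  wr_unit {X Y : K} {f f' : X ⟶ Y} (α : f ⟶ f') : wr α (𝟙 Y) ≍ α
  wr₃_unit {X Y : K} {f f' : X ⟶ Y} {α α' : f ⟶ f'} (Γ : α ⟶ α') : wr₃ Γ (𝟙 Y) ≍ Γ
  -- associativity laws
  comp_wl {W X Y Z : K} (f : W ⟶ X) (g : X ⟶ Y) {h h' : Y ⟶ Z} (α : h ⟶ h') :
    wl (f ≫ g) α ≍ wl f (wl g α)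
  comp_wl₃ {W X Y Z : K} (f : W ⟶ X) (g : X ⟶ Y) {h h' : Y ⟶ Z} {α α' : h ⟶ h'} (Γ : α ⟶ α') :
    wl₃ (f ≫ g) Γ ≍ wl₃ f (wl₃ g Γ)
  wr_wl {W X Y Z : K} (f : W ⟶ X) {g g' : X ⟶ Y} (α : g ⟶ g') (h : Y ⟶ Z) :
    wr (wl f α) h ≍ wl f (wr α h)
  wr₃_wl₃ {W X Y Z : K} (f : W ⟶ X) {g g' : X ⟶ Y} {α α' : g ⟶ g'} (Γ : α ⟶ α') (h : Y ⟶ Z) :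
    wr₃ (wl₃ f Γ) h ≍ wl₃ f (wr₃ Γ h)
  wr_wr {W X Y Z : K} {f f' : W ⟶ X} (α : f ⟶ f') (g : X ⟶ Y) (h : Y ⟶ Z) :
    wr (wr α g) h ≍ wr α (g ≫ h)
  wr₃_wr₃ {W X Y Z : K} {f f' : W ⟶ X} {α α' : f ⟶ f'} (Γ : α ⟶ α') (g : X ⟶ Y) (h : Y ⟶ Z) :
    wr₃ (wr₃ Γ g) h ≍ wr₃ Γ (g ≫ h)
  γ_wl {W X Y Z : K} (f : W ⟶ X) {g g' : X ⟶ Y} (α : g ⟶ g') {h h' : Y ⟶ Z} (β : h ⟶ h') :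
    (γ (wl f α) β).hom ≍ wl₃ f (γ α β).hom
  γ_mid {W X Y Z : K} {f f' : W ⟶ X} (α : f ⟶ f') (g : X ⟶ Y) {h h' : Y ⟶ Z} (β : h ⟶ h') :
    (γ (wr α g) β).hom ≍ (γ α (wl g β)).hom
  γ_wr {W X Y Z : K} {f f' : W ⟶ X} (α : f ⟶ f') {g g' : X ⟶ Y} (β : g ⟶ g') (h : Y ⟶ Z) :
    (γ α (wr β h)).hom ≍ wr₃ (γ α β).hom h
  -- naturality and functoriality of the interchange isomorphism in each variable
  γ_natural_left {X Y Z : K} {f f' : X ⟶ Y} {α α' : f ⟶ f'} (Γ : α ⟶ α') {g g' : Y ⟶ Z}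
    (β : g ⟶ g') : (wr₃ Γ g ▷ wl f' β) ≫ (γ α' β).hom = (γ α β).hom ≫ (wl f β ◁ wr₃ Γ g')
  γ_natural_right {X Y Z : K} {f f' : X ⟶ Y} (α : f ⟶ f') {g g' : Y ⟶ Z} {β β' : g ⟶ g'}
    (Θ : β ⟶ β') : (wr α g ◁ wl₃ f' Θ) ≫ (γ α β').hom = (γ α β).hom ≫ (wl₃ f Θ ▷ wr α g')
  γ_id_left {X Y Z : K} (f : X ⟶ Y) {g g' : Y ⟶ Z} (β : g ⟶ g') :
    (γ (𝟙 f) β).hom ≍ 𝟙 (wl f β)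
  γ_id_right {X Y Z : K} {f f' : X ⟶ Y} (α : f ⟶ f') (g : Y ⟶ Z) :
    (γ α (𝟙 g)).hom ≍ 𝟙 (wr α g)
  γ_comp_left {X Y Z : K} {f f' f'' : X ⟶ Y} (α : f ⟶ f') (α' : f' ⟶ f'') {g g' : Y ⟶ Z}
    (β : g ⟶ g') : (γ (α ≫ α') β).hom ≍
      (wr α g ◁ (γ α' β).hom ≫ (α_ _ _ _).inv ≫ (γ α β).hom ▷ wr α' g')
  γ_comp_right {X Y Z : K} {f f' : X ⟶ Y} (α : f ⟶ f') {g g' g'' : Y ⟶ Z} (β : g ⟶ g')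
    (β' : g' ⟶ g'') : (γ α (β ≫ β')).hom ≍
      ((γ α β).hom ▷ wl f' β' ≫ (α_ _ _ _).hom ≫ wl f β ◁ (γ α β').hom)

attribute [reducible, instance] GrayCategory.homBicategory
attribute [instance] GrayCategory.homStrict

section HEqLemmas

variable {B : Type*} [Bicategory B]

theorem comp_heq' {f g h f' g' h' : B} (hf : f = f') (hg : g = g') (hh : h = h')
    {x : f ⟶ g} {x' : f' ⟶ g'} {y : g ⟶ h} {y' : g' ⟶ h'} (hx : x ≍ x') (hy : y ≍ y') :
    x ≫ y ≍ x' ≫ y' := by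
  subst hf hg hh; cases hx; cases hy; rfl

/-- Transport of an isomorphism between 2-cells along equalities of their boundaries. -/
def castIso {f g f' g' : B} (hf : f = f') (hg : g = g') {x y : f ⟶ g} {x' y' : f' ⟶ g'}
    (hx : x ≍ x') (hy : y ≍ y') (e : x ≅ y) : x' ≅ y' := by
  subst hf hg
  exact eqToIso (eq_of_heq hx).symm ≪≫ e ≪≫ eqToIso (eq_of_heq hy)

theorem castIso_hom_heq {f g f' g' : B} (hf : f = f') (hg : g = g') {x y : f ⟶ g}
    {x' y' : f' ⟶ g'} (hx : x ≍ x') (hy : y ≍ y') (e : x ≅ y) :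
    (castIso hf hg hx hy e).hom ≍ e.hom := by
  subst hf hg; cases hx; cases hy
  simp [castIso]

theorem assoc_heq [Bicategory.Strict B] {a b c d b' c' : B} {p : a ⟶ b} {q : b ⟶ c} {r : c ⟶ d}
    {s : a ⟶ b'} {t : b' ⟶ c'} {u : c' ⟶ d} (y : (p ≫ q) ≫ r ⟶ s ≫ (t ≫ u)) :
    (α_ p q r).inv ≫ y ≫ (α_ s t u).inv ≍ y := by
  simp [Bicategory.Strict.associator_eqToIso]

end HEqLemmas

namespace GrayCategory

variable {K : Type*} [GrayCategory K]

theorem wl_heq {X Y Z : K} {f f' : X ⟶ Y} {g g' h h' : Y ⟶ Z} (hf : f = f') (hg : g = g')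
    (hh : h = h') {x : g ⟶ h} {x' : g' ⟶ h'} (hx : x ≍ x') : wl f x ≍ wl f' x' := by
  subst hf hg hh; cases hx; rfl

theorem wr_heq {X Y Z : K} {f f' : Y ⟶ Z} {g g' h h' : X ⟶ Y} (hf : f = f') (hg : g = g')
    (hh : h = h') {x : g ⟶ h} {x' : g' ⟶ h'} (hx : x ≍ x') : wr x f ≍ wr x' f' := by
  subst hf hg hh; cases hx; rfl

theorem wl₃_heq {X Y Z : K} {f f' : X ⟶ Y} {g g' h h' : Y ⟶ Z} (hf : f = f') (hg : g = g')
    (hh : h = h') {x y : g ⟶ h} {x' y' : g' ⟶ h'} (hx : x ≍ x') (hy : y ≍ y') {s : x ⟶ y}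
    {s' : x' ⟶ y'} (hs : s ≍ s') : wl₃ f s ≍ wl₃ f' s' := by
  subst hf hg hh; cases hx; cases hy; cases hs; rfl

theorem γ_heq {X Y Z : K} {f f' k k' : X ⟶ Y} {g g' h h' : Y ⟶ Z} (hf : f = f') (hk : k = k')
    (hg : g = g') (hh : h = h') {x : f ⟶ k} {x' : f' ⟶ k'} {y : g ⟶ h} {y' : g' ⟶ h'}
    (hx : x ≍ x') (hy : y ≍ y') : (γ x y).hom ≍ (γ x' y').hom := by
  subst hf hk hg hh; cases hx; cases hy; rfl

/-- The hexagon for the interchange isomorphisms of one 2-cell with a square of 2-cells. -/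
theorem hexagon {X Y Z : K} {f f' : X ⟶ Y} (α : f ⟶ f') {g g₁ g₂ h : Y ⟶ Z} (β : g ⟶ g₁)
    (δ' : g₁ ⟶ h) (δ : g ⟶ g₂) (β' : g₂ ⟶ h) (θ : β ≫ δ' ⟶ δ ≫ β')
    (t : wl f β ≫ wl f δ' ⟶ wl f δ ≫ wl f β') (ht : t ≍ wl₃ f θ)
    (t' : wl f' β ≫ wl f' δ' ⟶ wl f' δ ≫ wl f' β') (ht' : t' ≍ wl₃ f' θ) :
    (γ α β).hom ▷ wl f' δ' ≫ (α_ _ _ _).hom ≫ wl f β ◁ (γ α δ').hom ≫ (α_ _ _ _).inv ≫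
        t ▷ wr α h =
      (α_ _ _ _).hom ≫ wr α g ◁ t' ≫ (α_ _ _ _).inv ≫ (γ α δ).hom ▷ wl f' β' ≫
        (α_ _ _ _).hom ≫ wl f δ ◁ (γ α β').hom ≫ (α_ _ _ _).inv := by
  have key := γ_natural_right α θ
  have h1 := γ_comp_right α β δ'
  have h2 := γ_comp_right α δ β'
  have e1 := wl_comp f β δ'
  have e2 := wl_comp f δ β'
  have e1' := wl_comp f' β δ'
  have e2' := wl_comp f' δ β'
  generalize (γ α (β ≫ δ')).hom = G1 at key h1
  generalize (γ α (δ ≫ β')).hom = G2 at key h2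
  generalize wl₃ f θ = T at key ht
  generalize wl₃ f' θ = T' at key ht'
  generalize wl f (β ≫ δ') = P1 at *
  generalize wl f (δ ≫ β') = P2 at *
  generalize wl f' (β ≫ δ') = P1' at *
  generalize wl f' (δ ≫ β') = P2' at *
  subst e1 e2 e1' e2'
  cases ht; cases ht'
  have h1 := eq_of_heq (h1.trans (assoc_heq _).symm)
  have h2 := eq_of_heq (h2.trans (assoc_heq _).symm)
  subst h1 h2
  have key' := congrArg (fun z => (α_ _ _ _).hom ≫ z) key
  simp only [Category.assoc, Iso.hom_inv_id_assoc] at key'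
  exact key'.symm

theorem hexagon' {X Y Z : K} {f f' : X ⟶ Y} (α : f ⟶ f') {g g₁ g₂ h : Y ⟶ Z} (β : g ⟶ g₁)
    (δ' : g₁ ⟶ h) (δ : g ⟶ g₂) (β' : g₂ ⟶ h) (θ : β ≫ δ' ⟶ δ ≫ β')
    {p a b c ab ac bc r : X ⟶ Z} (hp : p = f ≫ g) (ha : a = f' ≫ g) (hb : b = f ≫ g₁)
    (hc : c = f ≫ g₂) (hab : ab = f' ≫ g₁) (hac : ac = f' ≫ g₂) (hbc : bc = f ≫ h)
    (hr : r = f' ≫ h)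
    {A : p ⟶ a} {A₁ : b ⟶ ab} {A₂ : c ⟶ ac} {A₃ : bc ⟶ r}
    {B : p ⟶ b} {B₁ : a ⟶ ab} {B₂ : c ⟶ bc} {B₃ : ac ⟶ r}
    {C : p ⟶ c} {C₁ : a ⟶ ac} {C₂ : b ⟶ bc} {C₃ : ab ⟶ r}
    (hA : A ≍ wr α g) (hA₁ : A₁ ≍ wr α g₁) (hA₂ : A₂ ≍ wr α g₂) (hA₃ : A₃ ≍ wr α h)
    (hB : B ≍ wl f β) (hB₁ : B₁ ≍ wl f' β) (hB₂ : B₂ ≍ wl f β') (hB₃ : B₃ ≍ wl f' β')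
    (hC : C ≍ wl f δ) (hC₁ : C₁ ≍ wl f' δ) (hC₂ : C₂ ≍ wl f δ') (hC₃ : C₃ ≍ wl f' δ')
    {x : A ≫ B₁ ⟶ B ≫ A₁} {y : A₁ ≫ C₃ ⟶ C₂ ≫ A₃} {z : B ≫ C₂ ⟶ C ≫ B₂}
    {x' : A₂ ≫ B₃ ⟶ B₂ ≫ A₃} {y' : A ≫ C₁ ⟶ C ≫ A₂} {z' : B₁ ≫ C₃ ⟶ C₁ ≫ B₃}
    (hx : x ≍ (γ α β).hom) (hy : y ≍ (γ α δ').hom) (hz : z ≍ wl₃ f θ)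
    (hx' : x' ≍ (γ α β').hom) (hy' : y' ≍ (γ α δ).hom) (hz' : z' ≍ wl₃ f' θ) :
    x ▷ C₃ ≫ (α_ _ _ _).hom ≫ B ◁ y ≫ (α_ _ _ _).inv ≫ z ▷ A₃ =
      (α_ _ _ _).hom ≫ A ◁ z' ≫ (α_ _ _ _).inv ≫ y' ▷ B₃ ≫
        (α_ _ _ _).hom ≫ C ◁ x' ≫ (α_ _ _ _).inv := by
  subst hp ha hb hc hab hac hbc hr
  cases hA; cases hA₁; cases hA₂; cases hA₃; cases hB; cases hB₁; cases hB₂; cases hB₃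
  cases hC; cases hC₁; cases hC₂; cases hC₃; cases hx; cases hy; cases hx'; cases hy'
  exact hexagon α β δ' δ β' θ z hz z' hz'

end GrayCategory

/-- A finite directed multigraph with a combinatorial embedding in an oriented surface.  A *dart*
`(e, true)` is the edge `e` seen from its source and traversed forwards; `(e, false)` is `e` seen
from its target and traversed backwards.  `rot` sends a dart to the next one, clockwise, around its
base vertex. -/
structure EmbeddedDigraph where
  Vertex : Type u
  Edge : Type u
  [finVertex : Finite Vertex]
  [finEdge : Finite Edge]
  src : Edge → Vertex
  tgt : Edge → Vertex
  rot : Equiv.Perm (Edge × Bool)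
  rot_cycle : ∀ d d' : Edge × Bool, rot.SameCycle d d' ↔
    (bif d.2 then src d.1 else tgt d.1) = (bif d'.2 then src d'.1 else tgt d'.1)

namespace EmbeddedDigraph

variable (G : EmbeddedDigraph.{u})

attribute [instance] finVertex finEdge

abbrev Dart : Type u := G.Edge × Bool

variable {G} in
/-- The vertex at which a dart starts. -/
def base (d : G.Dart) : G.Vertex := bif d.2 then G.src d.1 else G.tgt d.1

/-- The same edge, traversed the other way. -/
def rev : Equiv.Perm G.Dart where
  toFun d := (d.1, !d.2)
  invFun d := (d.1, !d.2)
  left_inv d := by simp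
  right_inv d := by simp

/-- The next dart along the boundary of the face on the left of a dart. -/
def next : Equiv.Perm G.Dart := G.rev.trans G.rot

/-- The faces of the embedded graph: the cycles of `next`. -/
def Face : Type u := Quotient (Equiv.Perm.SameCycle.setoid G.next)

variable {G} in
/-- The face on the left of a dart. -/
def leftFace (d : G.Dart) : G.Face := Quotient.mk _ d

instance : Finite G.Face := Quotient.finite _

instance : Quiver G.Vertex := ⟨fun a b => {e : G.Edge // G.src e = a ∧ G.tgt e = b}⟩

/-- Directed paths. -/
abbrev DPath (a b : G.Vertex) : Type u := Quiver.Path a b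

/-- There is no nontrivial directed path from a vertex to itself. -/
def Acyclic : Prop := ∀ (v : G.Vertex) (p : G.DPath v v), p.length = 0

variable {G} in
/-- The edges of a directed path, in order. -/
def edges {a : G.Vertex} : {b : G.Vertex} → Quiver.Path a b → List G.Edge
  | _, .nil => []
  | _, .cons p e => edges p ++ [e.1]

end EmbeddedDigraph

/-- A pasting scheme: a finite acyclic directed plane graph with distinct vertices `s` and `t` on
the exterior face such that every vertex lies on a directed path from `s` and on one to `t`.
Since such a graph is connected, Euler's formula says that the embedding is one in the plane. -/
structure PastingScheme extends EmbeddedDigraph.{u} where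
  outer : toEmbeddedDigraph.Face
  euler : Nat.card Vertex + Nat.card toEmbeddedDigraph.Face = Nat.card Edge + 2
  s : Vertex
  t : Vertex
  s_ne_t : s ≠ t
  s_outer : ∃ d : toEmbeddedDigraph.Dart, EmbeddedDigraph.base d = s ∧
    EmbeddedDigraph.leftFace d = outer
  t_outer : ∃ d : toEmbeddedDigraph.Dart, EmbeddedDigraph.base d = t ∧
    EmbeddedDigraph.leftFace d = outer
  reach : ∀ v : Vertex,
    Nonempty (toEmbeddedDigraph.DPath s v) ∧ Nonempty (toEmbeddedDigraph.DPath v t)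
  acyclic : toEmbeddedDigraph.Acyclic

namespace PastingScheme

open EmbeddedDigraph

variable {G : PastingScheme.{u}}

theorem edges_comp {a b c : G.Vertex} (p : Quiver.Path a b) (q : Quiver.Path b c) :
    edges (p.comp q) = edges p ++ edges q := by
  induction q with
  | nil => simp [edges]
  | cons q e ih => simp [edges, ih]

/-- An edge as a path. -/
def edgePath (e : G.Edge) : Quiver.Path (G.src e) (G.tgt e) :=
  Quiver.Path.cons .nil ⟨e, rfl, rfl⟩

theorem edges_edgePath (e : G.Edge) : edges (edgePath e) = [e] := rfl

theorem mem_edges {a b : G.Vertex} (p : Quiver.Path a b) (e : G.Edge) (h : e ∈ edges p) :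
    ∃ (x : Quiver.Path a (G.src e)) (y : Quiver.Path (G.tgt e) b),
      p = x.comp ((edgePath e).comp y) := by
  induction p with
  | nil => simp [edges] at h
  | cons p f ih =>
    rcases List.mem_append.1 h with h | h
    · obtain ⟨x, y, rfl⟩ := ih h
      exact ⟨x, y.cons f, rfl⟩
    · obtain ⟨f, rfl, rfl⟩ := f
      obtain rfl : e = f := by simpa using h
      exact ⟨p, .nil, rfl⟩

theorem loop_eq_nil {v : G.Vertex} (p : Quiver.Path v v) : p = .nil :=
  Quiver.Path.eq_nil_of_length_zero _ (G.acyclic v p)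

theorem no_return (e : G.Edge) (y : Quiver.Path (G.tgt e) (G.src e)) : False := by
  have := G.acyclic _ ((edgePath e).comp y)
  simp [edgePath] at this

theorem tgt_ne_s (e : G.Edge) : G.tgt e ≠ G.s := fun h => by
  obtain ⟨p⟩ := (G.reach (G.src e)).1
  exact no_return e (h ▸ p)

theorem src_ne_t (e : G.Edge) : G.src e ≠ G.t := fun h => by
  obtain ⟨p⟩ := (G.reach (G.tgt e)).2
  exact no_return e (h ▸ p)

theorem base_rot (d : G.Dart) : base (G.rot d) = base d :=
  ((G.rot_cycle (G.rot d) d).1 ((Equiv.Perm.sameCycle_apply_left).2 (.refl _ _)))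

theorem base_next (d : G.Dart) : base (G.next d) = base (G.rev d) := base_rot _

theorem leftFace_eq {d d' : G.Dart} : leftFace d = leftFace d' ↔ G.next.SameCycle d d' :=
  Quotient.eq

theorem leftFace_next (d : G.Dart) : leftFace (G.next d) = leftFace d :=
  leftFace_eq.2 (Equiv.Perm.sameCycle_apply_left.2 (.refl _ _))

theorem leftFace_next_pow (d : G.Dart) (n : ℕ) : leftFace ((G.next ^ n) d) = leftFace d :=
  leftFace_eq.2 (Equiv.Perm.sameCycle_pow_left.2 (.refl _ _))

/-- A run of darts traversed forwards. -/
theorem forward_run (d : G.Dart) (n : ℕ) (h : ∀ i < n, ((G.next ^ i) d).2 = true) :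
    ∃ p : Quiver.Path (base d) (base ((G.next ^ n) d)),
      edges p = (List.range n).map fun i => ((G.next ^ i) d).1 := by
  induction n with
  | zero => exact ⟨.nil, rfl⟩
  | succ n ih =>
    obtain ⟨p, hp⟩ := ih fun i hi => h i (by omega)
    have hn := h n (by omega)
    refine ⟨p.cons ⟨((G.next ^ n) d).1, ?_, ?_⟩, ?_⟩
    · simp [base, hn]
    · rw [pow_succ', Equiv.Perm.mul_apply, base_next]
      simp [base, rev, hn]
    · simp [edges, hp, List.range_succ]

/-- A run of darts traversed backwards. -/
theorem backward_run (d : G.Dart) (n : ℕ) (h : ∀ i < n, ((G.next ^ i) d).2 = false) :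
    ∃ p : Quiver.Path (base ((G.next ^ n) d)) (base d),
      edges p = ((List.range n).map fun i => ((G.next ^ i) d).1).reverse := by
  induction n with
  | zero => exact ⟨.nil, rfl⟩
  | succ n ih =>
    obtain ⟨p, hp⟩ := ih fun i hi => h i (by omega)
    have hn := h n (by omega)
    have h1 : base ((G.next ^ (n + 1)) d) = G.src ((G.next ^ n) d).1 := by
      rw [pow_succ', Equiv.Perm.mul_apply, base_next]
      simp [base, rev, hn]
    have h2 : base ((G.next ^ n) d) = G.tgt ((G.next ^ n) d).1 := by
      simp [base, hn]
    rw [h1]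
    generalize base ((G.next ^ n) d) = z at p h2
    subst h2
    refine ⟨(edgePath ((G.next ^ n) d).1).comp p, ?_⟩
    simp [edges_comp, edges_edgePath, List.range_succ, hp]

/-- Each face boundary contains darts in both directions. -/
theorem exists_dart (f : G.Face) (c : Bool) : ∃ d : G.Dart, leftFace d = f ∧ d.2 = c := by
  induction f using Quotient.inductionOn with
  | h d =>
  by_contra! H
  have H' : ∀ i, ((G.next ^ i) d).2 = !c := fun i => by
    have := H ((G.next ^ i) d) (leftFace_next_pow d i)
    revert this
    cases ((G.next ^ i) d).2 <;> cases c <;> simp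
  obtain ⟨n, hn, hd⟩ : ∃ n, 0 < n ∧ (G.next ^ n) d = d :=
    ⟨orderOf G.next, orderOf_pos _, by simp [pow_orderOf_eq_one]⟩
  cases c with
  | false =>
    obtain ⟨p, hp⟩ := forward_run d n fun i _ => by simpa using H' i
    generalize (G.next ^ n) d = d' at p hd
    subst hd
    rw [loop_eq_nil p] at hp
    have := congrArg List.length hp
    simp [edges] at this
    omega
  | true =>
    obtain ⟨p, hp⟩ := backward_run d n fun i _ => by simpa using H' i
    generalize (G.next ^ n) d = d' at p hd
    subst hd
    rw [loop_eq_nil p] at hp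
    have := congrArg List.length hp
    simp [edges] at this
    omega

/-- A Boolean function that is not constant on a cycle of a permutation changes its value
somewhere on that cycle, in each of the two ways. -/
theorem exists_switch {X : Type*} [Finite X] (σ : Equiv.Perm X) (b : X → Bool) (c : Bool) (x y : X)
    (h : σ.SameCycle x y) (hx : b x = c) (hy : b y = !c) :
    ∃ z, σ.SameCycle x z ∧ b z = c ∧ b (σ z) = !c := by
  by_contra! H
  obtain ⟨n, -, hn⟩ := h.exists_pow_eq'
  have key : ∀ i, b ((σ ^ i) x) = c := fun i => by
    induction i with
    | zero => simpa using hx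
    | succ i ih =>
      have := H ((σ ^ i) x) (Equiv.Perm.sameCycle_pow_right.2 (.refl _ _)) ih
      rw [pow_succ', Equiv.Perm.mul_apply]
      simpa using this
  have := key n
  rw [hn, hy] at this
  simp at this

theorem exists_face_switch (f : G.Face) (c : Bool) :
    ∃ d : G.Dart, leftFace d = f ∧ d.2 = c ∧ (G.next d).2 = !c := by
  obtain ⟨x, hx, hxc⟩ := exists_dart f c
  obtain ⟨y, hy, hyc⟩ := exists_dart f (!c)
  obtain ⟨z, h, h'⟩ := exists_switch G.next Prod.snd c x y (leftFace_eq.1 (hx.trans hy.symm)) hxc hyc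
  exact ⟨z, (leftFace_eq.2 h).symm.trans hx, h'⟩

theorem exists_out (v : G.Vertex) (h : v ≠ G.t) : ∃ e : G.Edge, G.src e = v := by
  obtain ⟨p⟩ := (G.reach v).2
  obtain ⟨c, e, q, rfl⟩ : ∃ c, ∃ (e : v ⟶ c) (q : G.DPath c G.t), p = e.toPath.comp q := by
    obtain ⟨c, e, q, hq, -⟩ := (Quiver.Path.length_ne_zero_iff_eq_comp p).1 fun h0 =>
      h (Quiver.Path.eq_of_length_zero p h0)
    exact ⟨c, e, q, hq⟩
  exact ⟨e.1, e.2.1⟩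

theorem exists_in (v : G.Vertex) (h : v ≠ G.s) : ∃ e : G.Edge, G.tgt e = v := by
  obtain ⟨p⟩ := (G.reach v).1
  cases p with
  | nil => exact absurd rfl h
  | cons p e => exact ⟨e.1, e.2.2⟩

theorem exists_vertex_switch (v : G.Vertex) (hs : v ≠ G.s) (ht : v ≠ G.t) (c : Bool) :
    ∃ d : G.Dart, base d = v ∧ d.2 = c ∧ (G.rot d).2 = !c := by
  obtain ⟨e, he⟩ := exists_out v ht
  obtain ⟨e', he'⟩ := exists_in v hs
  have key : ∀ c : Bool, ∃ d : G.Dart, base d = v ∧ d.2 = c := fun c => by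
    cases c with
    | true => exact ⟨(e, true), he, rfl⟩
    | false => exact ⟨(e', false), he', rfl⟩
  obtain ⟨x, hx, hxc⟩ := key c
  obtain ⟨y, hy, hyc⟩ := key (!c)
  obtain ⟨z, h, h'⟩ := exists_switch G.rot Prod.snd c x y ((G.rot_cycle x y).2 (hx.trans hy.symm))
    hxc hyc
  exact ⟨z, ((G.rot_cycle x z).1 h).symm.trans hx, h'⟩

theorem out_of_base_s (d : G.Dart) (h : base d = G.s) : d.2 = true := by
  obtain ⟨e, _ | _⟩ := d
  · exact absurd h (tgt_ne_s e)
  · rfl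

theorem in_of_base_t (d : G.Dart) (h : base d = G.t) : d.2 = false := by
  obtain ⟨e, _ | _⟩ := d
  · rfl
  · exact absurd h (src_ne_t e)

/-- By Euler's formula, along the boundary of each face the direction of the edges changes
exactly twice. -/
theorem face_switch_unique (d d' : G.Dart) (hf : leftFace d = leftFace d') (hd : d.2 = d'.2)
    (h : (G.next d).2 = !d.2) (h' : (G.next d').2 = !d'.2) : d = d' := by
  classical
  let W := (G.Face ⊕ {v : G.Vertex // v ≠ G.s ∧ v ≠ G.t}) × Bool
  have ne : ∀ d : G.Dart, ¬ (G.next d).2 = !d.2 → base (G.rev d) ≠ G.s ∧ base (G.rev d) ≠ G.t := by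
    intro d hd
    constructor <;> intro hb
    · have h1 := out_of_base_s _ hb
      have h2 := out_of_base_s (G.next d) (by rw [base_next, hb])
      simp [rev] at h1
      simp [h1, h2] at hd
    · have h1 := in_of_base_t _ hb
      have h2 := in_of_base_t (G.next d) (by rw [base_next, hb])
      simp [rev] at h1
      simp [h1, h2] at hd
  let Φ : G.Dart → W := fun d =>
    if h : (G.next d).2 = !d.2 then (.inl (leftFace d), d.2)
    else (.inr ⟨base (G.rev d), ne d h⟩, d.2)
  have surj : Function.Surjective Φ := by
    rintro ⟨f | ⟨v, hs, ht⟩, c⟩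
    · obtain ⟨d, hd, hc, hc'⟩ := exists_face_switch f c
      have h : (G.next d).2 = !d.2 := by rw [hc', hc]
      exact ⟨d, by simp only [Φ, dif_pos h, hd, hc]⟩
    · obtain ⟨d, hd, hc, hc'⟩ := exists_vertex_switch v hs ht (!c)
      have e1 : G.rev (G.rev d) = d := by simp [rev]
      have e2 : (G.rev d).2 = c := by simp [rev, hc]
      have h : ¬ (G.next (G.rev d)).2 = !(G.rev d).2 := by
        have : G.next (G.rev d) = G.rot d := by
          rw [next, Equiv.trans_apply, e1]
        rw [this, hc', e2]
        simp
      refine ⟨G.rev d, ?_⟩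
      simp only [Φ, dif_neg h, e1, e2, hd]
  have card : Nat.card G.Dart ≤ Nat.card W := by
    have e1 : Nat.card {v : G.Vertex // v ≠ G.s ∧ v ≠ G.t} + 2 = Nat.card G.Vertex := by
      have hst : Nat.card {v : G.Vertex // v = G.s ∨ v = G.t} = 2 := by
        have := Set.ncard_pair G.s_ne_t
        rwa [← Nat.card_coe_set_eq] at this
      have := Fintype.ofFinite G.Vertex
      have h2 := Fintype.card_subtype_compl fun v : G.Vertex => v = G.s ∨ v = G.t
      simp only [not_or, ← Nat.card_eq_fintype_card, hst] at h2
      have h3 : Nat.card {v : G.Vertex // v = G.s ∨ v = G.t} ≤ Nat.card G.Vertex :=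
        Nat.card_le_card_of_injective _ Subtype.val_injective
      simp only [ne_eq]
      omega
    have := G.euler
    simp only [W, Dart, Nat.card_prod, Nat.card_sum, Nat.card_eq_fintype_card (α := Bool),
      Fintype.card_bool]
    omega
  have inj : Function.Injective Φ :=
    (surj.bijective_of_nat_card_le card).injective
  apply inj
  simp only [Φ, dif_pos h, dif_pos h', hf, hd]

/-- The boundary of a face consists of two directed paths with common ends: one made of the edges
which have the face on their left, one made of the edges which have the face on their right. -/
theorem exists_boundary (f : G.Face) : ∃ (a b : G.Vertex) (l r : G.DPath a b),
    (∀ e, e ∈ edges l ↔ leftFace (e, true) = f) ∧ (∀ e, e ∈ edges r ↔ leftFace (e, false) = f) ∧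
    (∃ d : G.Dart, leftFace d = f ∧ d.2 = false ∧ (G.next d).2 = true ∧ base (G.next d) = a) ∧
    (∃ d : G.Dart, leftFace d = f ∧ d.2 = true ∧ (G.next d).2 = false ∧ base (G.next d) = b) := by
  classical
  obtain ⟨d0, hd0, hd0f, hd0n⟩ := exists_face_switch f false
  have run : ∀ (c : Bool) (d : G.Dart), leftFace d = f → d.2 = c →
      ∃ n, (∀ i < n, ((G.next ^ i) d).2 = c) ∧ ((G.next ^ n) d).2 = !c ∧
        ∃ d' : G.Dart, leftFace d' = f ∧ d'.2 = c ∧ (G.next d').2 = !c ∧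
          G.next d' = (G.next ^ n) d := by
    intro c d hd hc
    have ex : ∃ n, ((G.next ^ n) d).2 = !c := by
      obtain ⟨y, hy, hyc⟩ := exists_dart f (!c)
      obtain ⟨n, -, hn⟩ := (leftFace_eq.1 (hd.trans hy.symm)).exists_pow_eq'
      exact ⟨n, by rw [hn, hyc]⟩
    have hlt : ∀ i < Nat.find ex, ((G.next ^ i) d).2 = c := fun i hi => by
      have := Nat.find_min ex hi
      simpa using this
    refine ⟨Nat.find ex, hlt, Nat.find_spec ex, ?_⟩
    have hspec := Nat.find_spec ex
    generalize Nat.find ex = n at hlt hspec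
    cases n with
    | zero =>
      exfalso
      simp [hc] at hspec
    | succ n =>
      rw [pow_succ', Equiv.Perm.mul_apply] at hspec ⊢
      exact ⟨(G.next ^ n) d, (leftFace_next_pow d n).trans hd, hlt n (by omega), hspec, rfl⟩
  have h1 : leftFace (G.next d0) = f := (leftFace_next d0).trans hd0
  obtain ⟨n, hn, hn', x, hx, hxt, hxn, hxe⟩ := run true (G.next d0) h1 hd0n
  have h2 : leftFace (G.next x) = f := (leftFace_next x).trans hx
  obtain ⟨m, hm, hm', y, hy, hyt, hyn, hye⟩ := run false (G.next x) h2 hxn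
  have hyd : y = d0 := face_switch_unique y d0 (hy.trans hd0.symm) (hyt.trans hd0f.symm)
    (by rw [hyn, hyt]) (by rw [hd0n, hd0f, Bool.not_false])
  subst hyd
  obtain ⟨l, hl⟩ : ∃ l : G.DPath (base (G.next y)) (base (G.next x)),
      edges l = (List.range n).map fun i => ((G.next ^ i) (G.next y)).1 := by
    rw [hxe]
    exact forward_run _ n hn
  obtain ⟨r, hr⟩ : ∃ r : G.DPath (base (G.next y)) (base (G.next x)),
      edges r = ((List.range m).map fun i => ((G.next ^ i) (G.next x)).1).reverse := by
    rw [hye]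
    exact backward_run _ m hm
  have hn0 : 0 < n := Nat.pos_of_ne_zero fun h => by subst h; simp [hd0n] at hn'
  have hm0 : 0 < m := Nat.pos_of_ne_zero fun h => by subst h; simp [hxn] at hm'
  have all : ∀ k, (∃ i < n, (G.next ^ k) (G.next y) = (G.next ^ i) (G.next y)) ∨
      (∃ j < m, (G.next ^ k) (G.next y) = (G.next ^ j) (G.next x)) := by
    intro k
    induction k with
    | zero => exact .inl ⟨0, hn0, rfl⟩
    | succ k ih =>
      rw [pow_succ', Equiv.Perm.mul_apply]
      rcases ih with ⟨i, hi, h⟩ | ⟨j, hj, h⟩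
      · rw [h, ← Equiv.Perm.mul_apply, ← pow_succ']
        rcases Nat.lt_or_ge (i + 1) n with h' | h'
        · exact .inl ⟨i + 1, h', rfl⟩
        · obtain rfl : i + 1 = n := by omega
          exact .inr ⟨0, hm0, hxe.symm⟩
      · rw [h, ← Equiv.Perm.mul_apply, ← pow_succ']
        rcases Nat.lt_or_ge (j + 1) m with h' | h'
        · exact .inr ⟨j + 1, h', rfl⟩
        · obtain rfl : j + 1 = m := by omega
          exact .inl ⟨0, hn0, hye.symm⟩
  have all' : ∀ d : G.Dart, leftFace d = f →
      (∃ i < n, d = (G.next ^ i) (G.next y)) ∨ (∃ j < m, d = (G.next ^ j) (G.next x)) := by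
    intro d hd
    obtain ⟨k, -, rfl⟩ := (leftFace_eq.1 (h1.trans hd.symm)).exists_pow_eq'
    exact all k
  refine ⟨base (G.next y), base (G.next x), l, r, fun e => ?_, fun e => ?_,
    ⟨y, hy, hyt, hyn, rfl⟩, ⟨x, hx, hxt, hxn, rfl⟩⟩
  · rw [hl]
    simp only [List.mem_map, List.mem_range]
    constructor
    · rintro ⟨i, hi, rfl⟩
      have : (((G.next ^ i) (G.next y)).1, true) = (G.next ^ i) (G.next y) :=
        Prod.ext rfl (hn i hi).symm
      rw [this, leftFace_next_pow, h1]
    · intro h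
      rcases all' _ h with ⟨i, hi, h⟩ | ⟨j, hj, h⟩
      · exact ⟨i, hi, by rw [← h]⟩
      · have := hm j hj
        rw [← h] at this
        simp at this
  · rw [hr]
    simp only [List.mem_reverse, List.mem_map, List.mem_range]
    constructor
    · rintro ⟨i, hi, rfl⟩
      have : (((G.next ^ i) (G.next x)).1, false) = (G.next ^ i) (G.next x) :=
        Prod.ext rfl (hm i hi).symm
      rw [this, leftFace_next_pow, h2]
    · intro h
      rcases all' _ h with ⟨i, hi, h⟩ | ⟨j, hj, h⟩
      · have := hn i hi
        rw [← h] at this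
        simp at this
      · exact ⟨j, hj, by rw [← h]⟩

theorem exists_outer_boundary : ∃ l r : G.DPath G.s G.t,
    (∀ e, e ∈ edges l ↔ leftFace (e, true) = G.outer) ∧
    (∀ e, e ∈ edges r ↔ leftFace (e, false) = G.outer) := by
  obtain ⟨a, b, l, r, hl, hr, ⟨x, hx, hxf, hxn, rfl⟩, ⟨y, hy, hyt, hyn, rfl⟩⟩ :=
    exists_boundary G.outer
  obtain ⟨d, hd, hdo⟩ := G.s_outer
  obtain ⟨d', hd', hdo'⟩ := G.t_outer
  have prev : ∀ d : G.Dart, ∃ z, G.next z = d ∧ base (G.rev z) = base d := fun d =>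
    ⟨G.next.symm d, by simp, by rw [← base_next]; simp⟩
  have h1 : G.next x = d := by
    obtain ⟨z, rfl, hz⟩ := prev d
    have h1 := out_of_base_s _ hd
    have h2 := out_of_base_s (G.rev z) (hz.trans hd)
    have h3 : z.2 = false := by simpa [rev] using h2
    rw [face_switch_unique x z (hx.trans (hdo.symm.trans (leftFace_next z))) (hxf.trans h3.symm)
      (by rw [hxn, hxf]; rfl) (by rw [h1, h3]; rfl)]
  have h2 : G.next y = d' := by
    obtain ⟨z, rfl, hz⟩ := prev d'
    have h1 := in_of_base_t _ hd'
    have h2 := in_of_base_t (G.rev z) (hz.trans hd')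
    have h3 : z.2 = true := by simpa [rev] using h2
    rw [face_switch_unique y z (hy.trans (hdo'.symm.trans (leftFace_next z))) (hyt.trans h3.symm)
      (by rw [hyn, hyt]; rfl) (by rw [h1, h3]; rfl)]
  have hs : base (G.next x) = G.s := h1 ▸ hd
  have ht : base (G.next y) = G.t := h2 ▸ hd'
  rw [← hs, ← ht]
  exact ⟨l, r, hl, hr⟩

/-- The top path of a pasting scheme: the edges with the exterior face on their left. -/
noncomputable def top (G : PastingScheme.{u}) : G.DPath G.s G.t :=
  exists_outer_boundary.choose

/-- The bottom path of a pasting scheme: the edges with the exterior face on their right. -/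
noncomputable def bot (G : PastingScheme.{u}) : G.DPath G.s G.t :=
  exists_outer_boundary.choose_spec.choose

theorem mem_top (e : G.Edge) : e ∈ edges G.top ↔ leftFace (e, true) = G.outer :=
  exists_outer_boundary.choose_spec.choose_spec.1 e

theorem mem_bot (e : G.Edge) : e ∈ edges G.bot ↔ leftFace (e, false) = G.outer :=
  exists_outer_boundary.choose_spec.choose_spec.2 e

/-- The interior faces. -/
def IntFace (G : PastingScheme.{u}) : Type u := {f : G.Face // f ≠ G.outer}

instance : Finite G.IntFace := Subtype.finite

/-- The source of a face. -/
noncomputable def fs (F : G.IntFace) : G.Vertex := (exists_boundary F.1).choose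

/-- The target of a face. -/
noncomputable def ft (F : G.IntFace) : G.Vertex := (exists_boundary F.1).choose_spec.choose

/-- The lowermost path of a face: the edges which have the face on their left. -/
noncomputable def lower (F : G.IntFace) : G.DPath (fs F) (ft F) :=
  (exists_boundary F.1).choose_spec.choose_spec.choose

/-- The uppermost path of a face: the edges which have the face on their right. -/
noncomputable def upper (F : G.IntFace) : G.DPath (fs F) (ft F) :=
  (exists_boundary F.1).choose_spec.choose_spec.choose_spec.choose

theorem mem_lower (F : G.IntFace) (e : G.Edge) :
    e ∈ edges (lower F) ↔ leftFace (e, true) = F.1 :=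
  (exists_boundary F.1).choose_spec.choose_spec.choose_spec.choose_spec.1 e

theorem mem_upper (F : G.IntFace) (e : G.Edge) :
    e ∈ edges (upper F) ↔ leftFace (e, false) = F.1 :=
  (exists_boundary F.1).choose_spec.choose_spec.choose_spec.choose_spec.2.1 e

/-- `F ◁ H`: the lowermost path of `F` and the uppermost path of `H` share an edge. -/
def Above (F H : G.IntFace) : Prop := ∃ e, e ∈ edges (lower F) ∧ e ∈ edges (upper H)

end PastingScheme
namespace PastingScheme

open EmbeddedDigraph

variable {G : PastingScheme.{u}}

theorem path_ext {a b : G.Vertex} (p q : G.DPath a b) (h : ∀ e ∈ edges p, e ∈ edges q) :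
    p = q := by
  induction p with
  | nil => exact (loop_eq_nil q).symm
  | cons p f ih =>
    obtain ⟨f, rfl, rfl⟩ := f
    obtain ⟨x, y, rfl⟩ := mem_edges q f (h f (by simp [edges]))
    obtain rfl := loop_eq_nil y
    have : p = x := ih x fun e he => by
      have h1 := h e (by simp [edges, he])
      simp only [edges_comp, edges_edgePath, edges, List.mem_append, List.mem_singleton,
        List.append_nil] at h1
      rcases h1 with h1 | rfl
      · exact h1
      · obtain ⟨-, z, -⟩ := mem_edges p e he
        exact (no_return e z).elim
    rw [this]
    rfl

theorem decomp_unique {a u b : G.Vertex} (p p' : G.DPath a u) (q q' : G.DPath u b)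
    (h : p.comp q = p'.comp q') : p = p' ∧ q = q' := by
  have key : p = p' := path_ext _ _ fun e he => by
    have h1 : e ∈ edges (p'.comp q') := by rw [← h, edges_comp]; simp [he]
    rcases List.mem_append.1 (edges_comp p' q' ▸ h1) with h1 | h1
    · exact h1
    · obtain ⟨-, x, -⟩ := mem_edges p e he
      obtain ⟨y, -, -⟩ := mem_edges q' e h1
      exact (no_return e (x.comp y)).elim
  subst key
  exact ⟨rfl, Quiver.Path.comp_inj_right.1 h⟩

theorem subpath {a u v b : G.Vertex} (x : G.DPath a u) (y : G.DPath u b) (σ : G.DPath u v)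
    (h : ∀ e ∈ edges σ, e ∈ edges (x.comp y)) : ∃ z, y = σ.comp z := by
  induction σ with
  | nil => exact ⟨y, by simp⟩
  | cons σ f ih =>
    obtain ⟨f, rfl, rfl⟩ := f
    obtain ⟨z, rfl⟩ := ih fun e he => h e (by simp [edges, he])
    have h1 := h f (by simp [edges])
    rw [← Quiver.Path.comp_assoc, edges_comp, List.mem_append] at h1
    rcases h1 with h1 | h1
    · obtain ⟨-, w, -⟩ := mem_edges _ f h1
      exact (no_return f w).elim
    · obtain ⟨w, w', rfl⟩ := mem_edges _ f h1
      obtain rfl := loop_eq_nil w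
      exact ⟨w', by simp [edgePath, ← Quiver.Path.comp_assoc]⟩

theorem split_at {a u b : G.Vertex} (π : G.DPath a b) (e : G.Edge) (he : e ∈ edges π)
    (hu : G.src e = u) : ∃ (x : G.DPath a u) (y : G.DPath u b), π = x.comp y := by
  subst hu
  obtain ⟨x, y, h⟩ := mem_edges π e he
  exact ⟨x, _, h⟩

theorem edges_disjoint {a u b : G.Vertex} (p : G.DPath a u) (q : G.DPath u b) (e : G.Edge)
    (hp : e ∈ edges p) (hq : e ∈ edges q) : False := by
  obtain ⟨-, x, -⟩ := mem_edges p e hp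
  obtain ⟨y, -, -⟩ := mem_edges q e hq
  exact no_return e (x.comp y)

theorem length_pos {a b : G.Vertex} (p : G.DPath a b) (e : G.Edge) (h : e ∈ edges p) :
    p.length ≠ 0 := by
  cases p with
  | nil => simp [edges] at h
  | cons p f => simp

theorem exists_upper_edge (F : G.IntFace) : ∃ e : G.Edge, e ∈ edges (upper F) := by
  obtain ⟨⟨e, c⟩, hd, hc⟩ := exists_dart F.1 false
  obtain rfl : c = false := hc
  exact ⟨e, (mem_upper F e).2 hd⟩

theorem exists_first (F : G.IntFace) : ∃ e : G.Edge, e ∈ edges (upper F) ∧ G.src e = fs F := by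
  obtain ⟨e, he⟩ := exists_upper_edge F
  obtain ⟨c, f, q, hq, -⟩ := (Quiver.Path.length_ne_zero_iff_eq_comp _).1 (length_pos _ e he)
  exact ⟨f.1, by rw [hq]; simp [edges_comp, edges, Quiver.Hom.toPath], f.2.1⟩

/-- `F` can be applied to the path `π`, and turns it into `ρ`: the path `π` runs along the
uppermost path of `F`, and `ρ` is `π` with it replaced by the lowermost path of `F`. -/
structure Occ {a b : G.Vertex} (F : G.IntFace) (π ρ : G.DPath a b) where
  pre : G.DPath a (fs F)
  post : G.DPath (ft F) b
  eq_upper : π = pre.comp ((upper F).comp post)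
  eq_lower : ρ = pre.comp ((lower F).comp post)

theorem Occ.pre_post_eq {a b : G.Vertex} {F : G.IntFace} {π ρ ρ' : G.DPath a b} (o : Occ F π ρ)
    (o' : Occ F π ρ') : o.pre = o'.pre ∧ o.post = o'.post := by
  obtain ⟨h1, h2⟩ := decomp_unique _ _ _ _ (o.eq_upper.symm.trans o'.eq_upper)
  exact ⟨h1, Quiver.Path.comp_inj_right.1 h2⟩

theorem Occ.target_eq {a b : G.Vertex} {F : G.IntFace} {π ρ ρ' : G.DPath a b} (o : Occ F π ρ)
    (o' : Occ F π ρ') : ρ = ρ' := by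
  rw [o.eq_lower, o'.eq_lower, (o.pre_post_eq o').1, (o.pre_post_eq o').2]

instance {a b : G.Vertex} (F : G.IntFace) (π ρ : G.DPath a b) : Subsingleton (Occ F π ρ) :=
  ⟨fun o o' => by
    have h := o.pre_post_eq o'
    cases o; cases o'
    simp only at h
    obtain ⟨rfl, rfl⟩ := h
    rfl⟩

theorem exists_occ {a b : G.Vertex} (F : G.IntFace) (π : G.DPath a b)
    (h : ∀ e ∈ edges (upper F), e ∈ edges π) : ∃ ρ, Nonempty (Occ F π ρ) := by
  obtain ⟨e, he, hs⟩ := exists_first F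
  obtain ⟨x, y, rfl⟩ := split_at π e (h e he) hs
  obtain ⟨z, rfl⟩ := subpath x y _ h
  exact ⟨_, ⟨x, z, rfl, rfl⟩⟩

/-- `π` is turned into `π'` by applying the faces of a list in order. -/
inductive Sweep : List G.IntFace → G.DPath G.s G.t → G.DPath G.s G.t → Type u
  | nil (π : G.DPath G.s G.t) : Sweep [] π π
  | cons {F : G.IntFace} {l : List G.IntFace} {π ρ π' : G.DPath G.s G.t} (o : Occ F π ρ)
      (d : Sweep l ρ π') : Sweep (F :: l) π π'

instance (l : List G.IntFace) (π π' : G.DPath G.s G.t) : Subsingleton (Sweep l π π') := by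
  constructor
  intro d d'
  induction d with
  | nil => cases d'; rfl
  | cons o d ih =>
    cases d' with
    | cons o' d' =>
      obtain rfl := o.target_eq o'
      rw [Subsingleton.elim o o', ih d']

/-- A strict linear extension of `◁`, as the list of all interior faces in increasing order. -/
structure IsOrder (l : List G.IntFace) : Prop where
  nodup : l.Nodup
  mem : ∀ F, F ∈ l
  above : ∀ F H, Above F H → List.Sublist [F, H] l

theorem IsOrder.before {U V : List G.IntFace} {F : G.IntFace} (h : IsOrder (U ++ F :: V))
    (H : G.IntFace) (hH : Above H F) : H ∈ U := by
  have h1 := h.above H F hH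
  have nd := h.nodup
  obtain ⟨hF, hV⟩ : F ∉ U ∧ F ∉ V := by
    simp only [List.nodup_append, List.nodup_cons, List.mem_cons] at nd
    exact ⟨fun hU => nd.2.2 F hU F (.inl rfl) rfl, nd.2.1.1⟩
  obtain ⟨l₁, l₂, h2, h3, h4⟩ := List.sublist_append_iff.1 h1
  match l₁, h2, h3 with
  | [], h2, h3 =>
    subst h2
    cases h4 with
    | cons _ h4 => exact (hV (h4.subset (by simp))).elim
    | cons_cons _ h4 => exact (hV (h4.subset (by simp))).elim
  | X :: l₁, h2, h3 =>
    obtain ⟨rfl, -⟩ := List.cons.inj h2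
    exact h3.subset (by simp)

theorem IsOrder.after {U V : List G.IntFace} {F : G.IntFace} (h : IsOrder (U ++ F :: V))
    (H : G.IntFace) (hH : Above F H) : H ∈ V := by
  have h1 := h.above F H hH
  have nd := h.nodup
  obtain ⟨hF, hV⟩ : F ∉ U ∧ F ∉ V := by
    simp only [List.nodup_append, List.nodup_cons, List.mem_cons] at nd
    exact ⟨fun hU => nd.2.2 F hU F (.inl rfl) rfl, nd.2.1.1⟩
  obtain ⟨l₁, l₂, h2, h3, h4⟩ := List.sublist_append_iff.1 h1
  match l₁, h2, h3 with
  | [], h2, h3 =>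
    subst h2
    cases h4 with
    | cons _ h4 => exact (hV (h4.subset (by simp))).elim
    | cons_cons _ h4 => exact h4.subset (by simp)
  | X :: l₁, h2, h3 =>
    obtain ⟨rfl, -⟩ := List.cons.inj h2
    exact (hF (h3.subset (by simp))).elim

theorem exists_sweep_aux (U l : List G.IntFace) (h : IsOrder (U ++ l)) (π : G.DPath G.s G.t)
    (hπ : ∀ e, e ∈ edges π ↔
      (∀ F : G.IntFace, leftFace (e, true) = F.1 → F ∈ U) ∧
      (∀ F : G.IntFace, leftFace (e, false) = F.1 → F ∈ l)) : Nonempty (Sweep l π G.bot) := by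
  induction l generalizing U π with
  | nil =>
    have : G.bot = π := path_ext _ _ fun e he => by
      rw [mem_bot] at he
      exact (hπ e).2 ⟨fun F _ => by simpa using h.mem F, fun F hF => (F.2 (hF.symm.trans he)).elim⟩
    subst this
    exact ⟨.nil _⟩
  | cons F l ih =>
    have nd := h.nodup
    obtain ⟨ρ, ⟨o⟩⟩ := exists_occ F π fun e he => by
      refine (hπ e).2 ⟨fun H hH => h.before H ⟨e, (mem_lower H e).2 hH, he⟩, fun H hH => ?_⟩
      obtain rfl : H = F := Subtype.ext (hH.symm.trans ((mem_upper F e).1 he))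
      simp
    obtain ⟨d⟩ := ih (U ++ [F]) (by simpa using h) ρ fun e => by
      have h1 := hπ e
      rw [o.eq_upper] at h1
      rw [o.eq_lower]
      simp only [edges_comp, List.mem_append, mem_upper, mem_lower] at h1 ⊢
      have hFl : F ∉ l := by
        simp only [List.nodup_append, List.nodup_cons] at nd
        exact nd.2.1.1
      constructor
      · intro h2
        by_cases hl : leftFace (e, true) = F.1
        · exact ⟨fun H hH => by simp [Subtype.ext (hH.symm.trans hl)], fun H hH =>
            h.after H ⟨e, (mem_lower F e).2 hl, (mem_upper H e).2 hH⟩⟩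
        · have h3 := h1.1 (by tauto)
          have hr : ¬ leftFace (e, false) = F.1 := fun hr => by
            have hr' := (mem_upper F e).2 hr
            rcases h2 with h2 | h2 | h2
            · exact edges_disjoint _ _ e h2 hr'
            · exact hl h2
            · exact edges_disjoint _ _ e hr' h2
          refine ⟨fun H hH => .inl (h3.1 H hH), fun H hH => ?_⟩
          rcases List.mem_cons.1 (h3.2 H hH) with rfl | h4
          · exact (hr hH).elim
          · exact h4
      · rintro ⟨h2, h3⟩
        by_cases hl : leftFace (e, true) = F.1
        · exact .inr (.inl hl)
        · have h2' : ∀ H : G.IntFace, leftFace (e, true) = H.1 → H ∈ U := fun H hH => by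
            rcases h2 H hH with h4 | h4
            · exact h4
            · obtain rfl := List.mem_singleton.1 h4
              exact (hl hH).elim
          rcases h1.2 ⟨h2', fun H hH => List.mem_cons_of_mem _ (h3 H hH)⟩ with h4 | h4 | h4
          · exact .inl h4
          · exact (hFl (h3 F h4)).elim
          · exact .inr (.inr h4)
    exact ⟨.cons o d⟩

theorem exists_sweep (l : List G.IntFace) (h : IsOrder l) : Nonempty (Sweep l G.top G.bot) :=
  exists_sweep_aux [] l h _ fun e => by
    rw [mem_top]
    constructor
    · exact fun h1 => ⟨fun F hF => (F.2 (hF.symm.trans h1)).elim, fun F _ => h.mem F⟩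
    · rintro ⟨h1, -⟩
      by_contra hne
      exact List.not_mem_nil (h1 ⟨_, hne⟩ rfl)

/-- Relative position of two disjoint occurrences in a path: the first one comes before the second
one, and `mid` lies in between. -/
structure Between {a b : G.Vertex} {F H : G.IntFace} {π π₁ π₂ : G.DPath a b} (o : Occ F π π₁)
    (o' : Occ H π π₂) where
  mid : G.DPath (ft F) (fs H)
  post_eq : o.post = mid.comp ((upper H).comp o'.post)
  pre_eq : o'.pre = o.pre.comp ((upper F).comp mid)

theorem between_aux {a b : G.Vertex} {F H : G.IntFace} (hFH : F ≠ H) {π π₁ π₂ : G.DPath a b}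
    (o : Occ F π π₁) (o' : Occ H π π₂) (e : G.Edge) (he : e ∈ edges (upper H))
    (hs : G.src e = fs H) :
    Nonempty (G.DPath (G.tgt e) (fs F)) ∨ Nonempty (Between o o') := by
  have h1 : e ∈ edges π := by rw [o'.eq_upper]; simp [edges_comp, he]
  rw [o.eq_upper, edges_comp, edges_comp, List.mem_append, List.mem_append] at h1
  rcases h1 with h1 | h1 | h1
  · obtain ⟨-, y, -⟩ := mem_edges _ e h1
    exact .inl ⟨y⟩
  · exact absurd (Subtype.ext (((mem_upper F e).1 h1).symm.trans ((mem_upper H e).1 he))) hFH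
  · obtain ⟨x, y, hy⟩ := split_at _ e h1 hs
    have hπ : π = (o.pre.comp ((upper F).comp x)).comp y :=
      o.eq_upper.trans (by rw [hy]; simp only [Quiver.Path.comp_assoc])
    obtain ⟨z, rfl⟩ := subpath _ y (upper H) fun e he => by
      rw [← hπ, o'.eq_upper]
      simp [edges_comp, he]
    obtain ⟨h2, h3⟩ := decomp_unique _ _ _ _ (o'.eq_upper.symm.trans hπ)
    refine .inr ⟨x, ?_, h2⟩
    rw [hy, ← h3]

theorem between_total {a b : G.Vertex} {F H : G.IntFace} (hFH : F ≠ H) {π π₁ π₂ : G.DPath a b}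
    (o : Occ F π π₁) (o' : Occ H π π₂) : Nonempty (Between o o') ∨ Nonempty (Between o' o) := by
  obtain ⟨e, he, hs⟩ := exists_first H
  obtain ⟨f, hf, hs'⟩ := exists_first F
  rcases between_aux hFH o o' e he hs with ⟨⟨y⟩⟩ | h
  · rcases between_aux hFH.symm o' o f hf hs' with ⟨⟨z⟩⟩ | h
    · rw [← hs'] at y
      rw [← hs] at z
      exact (no_return e (y.comp ((edgePath f).comp z))).elim
    · exact .inr h
  · exact .inl h

theorem between_asymm {a b : G.Vertex} {F H : G.IntFace} {π π₁ π₂ : G.DPath a b} (o : Occ F π π₁)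
    (o' : Occ H π π₂) (z : Between o o') (z' : Between o' o) : False := by
  obtain ⟨e, he⟩ := exists_upper_edge F
  have h := z.pre_eq
  rw [z'.pre_eq] at h
  have h := congrArg Quiver.Path.length h
  have := length_pos _ e he
  simp only [Quiver.Path.length_comp] at h
  omega

instance {a b : G.Vertex} {F H : G.IntFace} {π π₁ π₂ : G.DPath a b} (o : Occ F π π₁)
    (o' : Occ H π π₂) : Subsingleton (Between o o') := by
  constructor
  rintro ⟨m, h1, -⟩ ⟨m', h1', -⟩
  obtain rfl : m = m' := Quiver.Path.comp_inj_left.1 (h1.symm.trans h1')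
  rfl

/-- After `F` has been applied, `H` can still be applied further along. -/
theorem Between.second {a b : G.Vertex} {F H : G.IntFace} {π π₁ π₂ ρ : G.DPath a b} {o : Occ F π π₁}
    {o' : Occ H π π₂} (z : Between o o') (o₁' : Occ H π₁ ρ) :
    o₁'.pre = o.pre.comp ((lower F).comp z.mid) ∧ o₁'.post = o'.post :=
  o₁'.pre_post_eq (ρ' := (o.pre.comp ((lower F).comp z.mid)).comp ((lower H).comp o'.post))
    ⟨_, _, o.eq_lower.trans (by rw [z.post_eq]; simp only [Quiver.Path.comp_assoc]), rfl⟩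

/-- After `H` has been applied, `F` can still be applied further back. -/
theorem Between.first {a b : G.Vertex} {F H : G.IntFace} {π π₁ π₂ ρ : G.DPath a b} {o : Occ F π π₁}
    {o' : Occ H π π₂} (z : Between o o') (o₁ : Occ F π₂ ρ) :
    o₁.pre = o.pre ∧ o₁.post = z.mid.comp ((lower H).comp o'.post) :=
  o₁.pre_post_eq (ρ' := o.pre.comp ((lower F).comp (z.mid.comp ((lower H).comp o'.post))))
    ⟨_, _, o'.eq_lower.trans (by rw [z.pre_eq]; simp only [Quiver.Path.comp_assoc]), rfl⟩

section

variable {a b : G.Vertex} {F H : G.IntFace} {π π₁ π₂ ρ : G.DPath a b} {o : Occ F π π₁}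
  {o' : Occ H π π₂}

theorem Between.eq_source (z : Between o o') :
    π = o.pre.comp ((upper F).comp (z.mid.comp ((upper H).comp o'.post))) :=
  o.eq_upper.trans (by rw [z.post_eq])

theorem Between.eq_left (z : Between o o') :
    π₁ = o.pre.comp ((lower F).comp (z.mid.comp ((upper H).comp o'.post))) :=
  o.eq_lower.trans (by rw [z.post_eq])

theorem Between.eq_right (z : Between o o') :
    π₂ = o.pre.comp ((upper F).comp (z.mid.comp ((lower H).comp o'.post))) :=
  o'.eq_lower.trans (by rw [z.pre_eq]; simp only [Quiver.Path.comp_assoc])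

theorem Between.eq_target (z : Between o o') (o₁' : Occ H π₁ ρ) :
    ρ = o.pre.comp ((lower F).comp (z.mid.comp ((lower H).comp o'.post))) :=
  o₁'.eq_lower.trans (by
    rw [(z.second o₁').1, (z.second o₁').2]; simp only [Quiver.Path.comp_assoc])

end

theorem Between.corner {a b : G.Vertex} {F H : G.IntFace} {π π₁ π₂ ρ ρ' : G.DPath a b}
    {o : Occ F π π₁} {o' : Occ H π π₂} (z : Between o o') (o₁' : Occ H π₁ ρ) (o₁ : Occ F π₂ ρ') :
    ρ = ρ' := by
  rw [o₁'.eq_lower, o₁.eq_lower, (z.second o₁').1, (z.second o₁').2, (z.first o₁).1,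
    (z.first o₁).2]
  simp only [Quiver.Path.comp_assoc]

theorem corner {a b : G.Vertex} {F H : G.IntFace} (hFH : F ≠ H) {π π₁ π₂ ρ ρ' : G.DPath a b}
    (o : Occ F π π₁) (o' : Occ H π π₂) (o₁' : Occ H π₁ ρ) (o₁ : Occ F π₂ ρ') : ρ = ρ' := by
  rcases between_total hFH o o' with ⟨⟨z⟩⟩ | ⟨⟨z⟩⟩
  · exact z.corner o₁' o₁
  · exact (z.corner o₁ o₁').symm

/-- The possible orders of composition: the strict linear extensions of `◁`. -/
structure Order (G : PastingScheme.{u}) where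
  list : List G.IntFace
  isOrder : IsOrder list

theorem Order.ne {x : G.Order} {U V : List G.IntFace} {F H : G.IntFace}
    (h : x.list = U ++ F :: H :: V) : F ≠ H := by
  have nd := x.isOrder.nodup
  rw [h] at nd
  simp only [List.nodup_append, List.nodup_cons, List.mem_cons] at nd
  tauto

/-- The generating morphisms `U F H V ⟶ U H F V`. -/
structure Swap (x y : G.Order) where
  U : List G.IntFace
  F : G.IntFace
  H : G.IntFace
  V : List G.IntFace
  eq_source : x.list = U ++ F :: H :: V
  eq_target : y.list = U ++ H :: F :: V

instance : Quiver G.Order := ⟨Swap⟩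

/-- A generating morphism, in the free category. -/
def gen {x y : G.Order} (e : Swap x y) : (Paths.of G.Order).obj x ⟶ (Paths.of G.Order).obj y :=
  (Paths.of G.Order).map e

/-- The relations between the generating morphisms: exchanging two faces twice is the identity,
exchanges at disjoint places commute, and the two ways of reversing three consecutive faces
agree. -/
inductive Rel : HomRel (Paths G.Order)
  | invol {x y : G.Order} (U V : List G.IntFace) (F H : G.IntFace)
      (hx : x.list = U ++ F :: H :: V) (hy : y.list = U ++ H :: F :: V) :
      Rel (gen ⟨U, F, H, V, hx, hy⟩ ≫ gen ⟨U, H, F, V, hy, hx⟩) (𝟙 ((Paths.of G.Order).obj x))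
  | comm {x y z w : G.Order} (U V W : List G.IntFace) (F H I J : G.IntFace)
      (hx : x.list = U ++ F :: H :: (V ++ I :: J :: W)) (hy : y.list = U ++ H :: F :: (V ++ I :: J :: W))
      (hz : z.list = U ++ F :: H :: (V ++ J :: I :: W)) (hw : w.list = U ++ H :: F :: (V ++ J :: I :: W)) :
      Rel (gen (⟨U, F, H, V ++ I :: J :: W, hx, hy⟩ : Swap x y) ≫
          gen (⟨U ++ H :: F :: V, I, J, W, by simp [hy], by simp [hw]⟩ : Swap y w))
        (gen (⟨U ++ F :: H :: V, I, J, W, by simp [hx], by simp [hz]⟩ : Swap x z) ≫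
          gen (⟨U, F, H, V ++ J :: I :: W, hz, hw⟩ : Swap z w))
  | hexagon {x₁ x₂ x₃ y₂ y₃ z : G.Order} (U V : List G.IntFace) (A B C : G.IntFace)
      (h₁ : x₁.list = U ++ A :: B :: C :: V) (h₂ : x₂.list = U ++ B :: A :: C :: V)
      (h₃ : x₃.list = U ++ B :: C :: A :: V) (k₂ : y₂.list = U ++ A :: C :: B :: V)
      (k₃ : y₃.list = U ++ C :: A :: B :: V) (h : z.list = U ++ C :: B :: A :: V) :
      Rel (gen (⟨U, A, B, C :: V, h₁, h₂⟩ : Swap x₁ x₂) ≫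
          gen (⟨U ++ [B], A, C, V, by simp [h₂], by simp [h₃]⟩ : Swap x₂ x₃) ≫
          gen (⟨U, B, C, A :: V, h₃, h⟩ : Swap x₃ z))
        (gen (⟨U ++ [A], B, C, V, by simp [h₁], by simp [k₂]⟩ : Swap x₁ y₂) ≫
          gen (⟨U, A, C, B :: V, k₂, k₃⟩ : Swap y₂ y₃) ≫
          gen (⟨U ++ [C], A, B, V, by simp [k₃], by simp [h]⟩ : Swap y₃ z))

/-- The category of orders of composition of a pasting scheme. -/
abbrev Orders (G : PastingScheme.{u}) := Quotient (Rel (G := G))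

/-- An order of composition, as an object of `Orders G`. -/
def Order.toOrders (x : G.Order) : Orders G :=
  (Quotient.functor (Rel (G := G))).obj ((Paths.of G.Order).obj x)

end PastingScheme

open EmbeddedDigraph PastingScheme GrayCategory

/-- The composite 1-cell along a path. -/
def pathCell {G : PastingScheme.{u}} {K : Type*} [GrayCategory K] (φ : G.Vertex ⥤q K)
    {a b : G.Vertex} (p : G.DPath a b) : φ.obj a ⟶ φ.obj b :=
  composePath (φ.mapPath p)

/-- A labelling of a pasting scheme in a Gray-category: a 0-cell for each vertex and a 1-cell for
each edge (together, a morphism of quivers) and a 2-cell for each interior face, from the composite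
of its uppermost path to the composite of its lowermost path. -/
structure Labelling (G : PastingScheme.{u}) (K : Type*) [GrayCategory K] where
  cells : G.Vertex ⥤q K
  face (F : G.IntFace) : pathCell cells (upper F) ⟶ pathCell cells (lower F)

namespace Labelling

variable {G : PastingScheme.{u}} {K : Type*} [GrayCategory K] (L : Labelling G K)

/-- The composite 1-cell along a path. -/
abbrev path {a b : G.Vertex} (p : G.DPath a b) : L.cells.obj a ⟶ L.cells.obj b :=
  pathCell L.cells p

theorem path_comp {a b c : G.Vertex} (p : G.DPath a b) (q : G.DPath b c) :
    L.path (p.comp q) = L.path p ≫ L.path q := by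
  simp [pathCell, Prefunctor.mapPath_comp]

theorem path_comp₃ {a b c d : G.Vertex} (p : G.DPath a b) (q : G.DPath b c) (r : G.DPath c d) :
    L.path (p.comp (q.comp r)) = L.path p ≫ L.path q ≫ L.path r := by
  rw [path_comp, path_comp]

/-- A 2-cell `β` with the boundary of a face `F`, whiskered by the labels of the rest of a path
through `F`. -/
noncomputable def whisk {a b : G.Vertex} {F : G.IntFace} {π ρ : G.DPath a b} (o : Occ F π ρ)
    (β : L.path (upper F) ⟶ L.path (lower F)) : L.path π ⟶ L.path ρ :=
  eqToHom ((congrArg L.path o.eq_upper).trans (L.path_comp₃ _ _ _)) ≫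
    wl (L.path o.pre) (wr β (L.path o.post)) ≫
      eqToHom ((congrArg L.path o.eq_lower).trans (L.path_comp₃ _ _ _)).symm

/-- A 3-cell between 2-cells with the boundary of a face `F`, whiskered by the labels of the rest
of a path through `F`. -/
noncomputable def whisk₃ {a b : G.Vertex} {F : G.IntFace} {π ρ : G.DPath a b} (o : Occ F π ρ)
    {β β' : L.path (upper F) ⟶ L.path (lower F)} (Γ : β ⟶ β') : L.whisk o β ⟶ L.whisk o β' :=
  eqToHom ((congrArg L.path o.eq_upper).trans (L.path_comp₃ _ _ _)) ◁
    (wl₃ (L.path o.pre) (wr₃ Γ (L.path o.post)) ▷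
      eqToHom ((congrArg L.path o.eq_lower).trans (L.path_comp₃ _ _ _)).symm)

/-- The label of a face, whiskered by the labels of the rest of a path through the face. -/
noncomputable def step {a b : G.Vertex} {F : G.IntFace} {π ρ : G.DPath a b} (o : Occ F π ρ) :
    L.path π ⟶ L.path ρ :=
  L.whisk o (L.face F)

theorem step_heq {a b : G.Vertex} {F : G.IntFace} {π ρ : G.DPath a b} (o : Occ F π ρ) :
    L.step o ≍ wl (L.path o.pre) (wr (L.face F) (L.path o.post)) := by
  exact (eqToHom_comp_heq _ _).trans (comp_eqToHom_heq _ _)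

theorem step_heq' {a b : G.Vertex} {F : G.IntFace} {π ρ : G.DPath a b} (o : Occ F π ρ)
    {x : G.DPath a (fs F)} {y : G.DPath (ft F) b} (hx : o.pre = x) (hy : o.post = y) :
    L.step o ≍ wl (L.path x) (wr (L.face F) (L.path y)) := by
  subst hx hy
  exact L.step_heq o

theorem step_heq_wr {a b : G.Vertex} {F : G.IntFace} {π ρ : G.DPath a b} (o : Occ F π ρ)
    {x : G.DPath a (fs F)} {y : G.DPath (ft F) b} (hx : o.pre = x)
    (hy : o.post = y) :
    L.step o ≍ wr (wl (L.path x) (L.face F)) (L.path y) :=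
  (L.step_heq' o hx hy).trans (wr_wl _ _ _).symm

theorem path_comp₅ {a b c d e f : G.Vertex} (p : G.DPath a b) (q : G.DPath b c) (r : G.DPath c d)
    (s : G.DPath d e) (t : G.DPath e f) : L.path (p.comp (q.comp (r.comp (s.comp t)))) =
      (L.path p ≫ L.path q) ≫ L.path r ≫ L.path s ≫ L.path t := by
  simp only [path_comp, Category.assoc]

theorem step_left_heq {a b : G.Vertex} {F H : G.IntFace} {π π₁ π₂ : G.DPath a b} (o : Occ F π π₁)
    (o' : Occ H π π₂) (z : Between o o') : L.step o ≍ wr (wl (L.path o.pre) (L.face F))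
      (L.path z.mid ≫ L.path (upper H) ≫ L.path o'.post) := by
  rw [← path_comp₃]
  exact L.step_heq_wr o rfl z.post_eq

theorem step_second_heq {a b : G.Vertex} {F H : G.IntFace} {π π₁ π₂ ρ : G.DPath a b} {o : Occ F π π₁}
    {o' : Occ H π π₂} (o₁' : Occ H π₁ ρ) (z : Between o o') :
    L.step o₁' ≍ wl (L.path o.pre ≫ L.path (lower F))
      (wl (L.path z.mid) (wr (L.face H) (L.path o'.post))) := by
  refine (L.step_heq' o₁' (z.second o₁').1 (z.second o₁').2).trans (HEq.trans ?_ (comp_wl _ _ _))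
  exact wl_heq ((L.path_comp₃ _ _ _).trans (Category.assoc _ _ _).symm) rfl rfl HEq.rfl

theorem step_right_heq {a b : G.Vertex} {F H : G.IntFace} {π π₁ π₂ : G.DPath a b} (o : Occ F π π₁)
    (o' : Occ H π π₂) (z : Between o o') : L.step o' ≍ wl (L.path o.pre ≫ L.path (upper F))
      (wl (L.path z.mid) (wr (L.face H) (L.path o'.post))) := by
  refine (L.step_heq' o' z.pre_eq rfl).trans (HEq.trans ?_ (comp_wl _ _ _))
  exact wl_heq ((L.path_comp₃ _ _ _).trans (Category.assoc _ _ _).symm) rfl rfl HEq.rfl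

theorem step_first_heq {a b : G.Vertex} {F H : G.IntFace} {π π₁ π₂ ρ : G.DPath a b} {o : Occ F π π₁}
    {o' : Occ H π π₂} (o₁ : Occ F π₂ ρ) (z : Between o o') :
    L.step o₁ ≍ wr (wl (L.path o.pre) (L.face F))
      (L.path z.mid ≫ L.path (lower H) ≫ L.path o'.post) := by
  rw [← path_comp₃]
  exact L.step_heq_wr o₁ (z.first o₁).1 (z.first o₁).2

/-- The interchange isomorphism for two faces which can be applied to the same path, the first one
further back than the second one. -/
noncomputable def sqAux {a b : G.Vertex} {F H : G.IntFace} {π π₁ π₂ ρ : G.DPath a b}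
    {o : Occ F π π₁} {o₁' : Occ H π₁ ρ} {o' : Occ H π π₂} {o₁ : Occ F π₂ ρ} (z : Between o o') :
    L.step o ≫ L.step o₁' ≅ L.step o' ≫ L.step o₁ :=
  have h₀ := (congrArg L.path z.eq_source).trans (L.path_comp₅ _ _ _ _ _)
  have h₁ := (congrArg L.path z.eq_left).trans (L.path_comp₅ _ _ _ _ _)
  have h₂ := (congrArg L.path z.eq_right).trans (L.path_comp₅ _ _ _ _ _)
  have h₃ := (congrArg L.path (z.eq_target o₁')).trans (L.path_comp₅ _ _ _ _ _)
  castIso h₀.symm h₃.symm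
    (comp_heq' h₀ h₁ h₃ (L.step_left_heq o o' z) (L.step_second_heq o₁' z)).symm
    (comp_heq' h₀ h₂ h₃ (L.step_right_heq o o' z) (L.step_first_heq o₁ z)).symm
    (γ (wl (L.path o.pre) (L.face F)) (wl (L.path z.mid) (wr (L.face H) (L.path o'.post))))

theorem sqAux_heq {a b : G.Vertex} {F H : G.IntFace} {π π₁ π₂ ρ : G.DPath a b}
    {o : Occ F π π₁} {o₁' : Occ H π₁ ρ} {o' : Occ H π π₂} {o₁ : Occ F π₂ ρ} (z : Between o o') :
    (L.sqAux z (o₁' := o₁') (o₁ := o₁)).hom ≍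
      (γ (wl (L.path o.pre) (L.face F))
        (wl (L.path z.mid) (wr (L.face H) (L.path o'.post)))).hom :=
  castIso_hom_heq _ _ _ _ _

open Classical in
/-- The interchange isomorphism for two different faces which can be applied to the same path. -/
noncomputable def sq {a b : G.Vertex} {F H : G.IntFace} (hFH : F ≠ H) {π π₁ π₂ ρ : G.DPath a b}
    (o : Occ F π π₁) (o₁' : Occ H π₁ ρ) (o' : Occ H π π₂) (o₁ : Occ F π₂ ρ) :
    L.step o ≫ L.step o₁' ≅ L.step o' ≫ L.step o₁ :=
  if h : Nonempty (Between o o') then L.sqAux h.some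
  else (L.sqAux ((between_total hFH o o').resolve_left h).some).symm

theorem sq_eq {a b : G.Vertex} {F H : G.IntFace} (hFH : F ≠ H) {π π₁ π₂ ρ : G.DPath a b}
    (o : Occ F π π₁) (o₁' : Occ H π₁ ρ) (o' : Occ H π π₂) (o₁ : Occ F π₂ ρ) (z : Between o o') :
    L.sq hFH o o₁' o' o₁ = L.sqAux z := by
  rw [sq, dif_pos ⟨z⟩, Subsingleton.elim (Nonempty.some _) z]

theorem sq_symm {a b : G.Vertex} {F H : G.IntFace} (hFH : F ≠ H) {π π₁ π₂ ρ : G.DPath a b}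
    (o : Occ F π π₁) (o₁' : Occ H π₁ ρ) (o' : Occ H π π₂) (o₁ : Occ F π₂ ρ) :
    (L.sq hFH o o₁' o' o₁).symm = L.sq hFH.symm o' o₁ o o₁' := by
  rcases between_total hFH o o' with ⟨⟨z⟩⟩ | ⟨⟨z⟩⟩
  · have h : ¬ Nonempty (Between o' o) := fun ⟨z'⟩ => between_asymm _ _ z z'
    rw [L.sq_eq hFH _ _ _ _ z, sq, dif_neg h, Subsingleton.elim (Nonempty.some _) z]
  · have h : ¬ Nonempty (Between o o') := fun ⟨z'⟩ => between_asymm _ _ z z'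
    rw [L.sq_eq hFH.symm _ _ _ _ z, sq, dif_neg h, Subsingleton.elim (Nonempty.some _) z]
    rfl

/-- The composite of the labels of the faces of a list, whiskered and composed in that order. -/
noncomputable def comp {l : List G.IntFace} {π π' : G.DPath G.s G.t} :
    Sweep l π π' → (L.path π ⟶ L.path π')
  | .nil _ => 𝟙 _
  | .cons o d => L.step o ≫ comp d

/-- The interchange isomorphism for the first two faces of a list. -/
noncomputable def swapHead {F H : G.IntFace} (hFH : F ≠ H) {V : List G.IntFace}
    {π π' : G.DPath G.s G.t} (d : Sweep (F :: H :: V) π π') (d' : Sweep (H :: F :: V) π π') :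
    L.comp d ≅ L.comp d' :=
  match d, d' with
  | .cons o (.cons o₁' r), .cons o' (.cons o₁ r') => by
    have h := corner hFH o o' o₁' o₁
    subst h
    have h := Subsingleton.elim r r'
    subst h
    exact (α_ _ _ _).symm ≪≫ whiskerRightIso (L.sq hFH o o₁' o' o₁) (L.comp r) ≪≫ α_ _ _ _

/-- The interchange isomorphism for two consecutive faces of a list. -/
noncomputable def swap {F H : G.IntFace} (hFH : F ≠ H) {V : List G.IntFace} :
    (U : List G.IntFace) → {l l' : List G.IntFace} → (hl : l = U ++ F :: H :: V) →
    (hl' : l' = U ++ H :: F :: V) → {π π' : G.DPath G.s G.t} → (d : Sweep l π π') →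
    (d' : Sweep l' π π') → (L.comp d ≅ L.comp d')
  | [], _, _, hl, hl', _, _, d, d' => by
    subst hl hl'
    exact L.swapHead hFH d d'
  | X :: U, _, _, hl, hl', _, _, d, d' => by
    subst hl hl'
    exact match d, d' with
    | .cons o r, .cons o' r' => by
      have h := o.target_eq o'
      subst h
      have h := Subsingleton.elim o o'
      subst h
      exact whiskerLeftIso (L.step o) (swap hFH U rfl rfl r r')

theorem swapHead_cons {F H : G.IntFace} (hFH : F ≠ H) {V : List G.IntFace}
    {π π' π₁ π₂ ρ : G.DPath G.s G.t} (o : Occ F π π₁) (o₁' : Occ H π₁ ρ) (o' : Occ H π π₂)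
    (o₁ : Occ F π₂ ρ) (r : Sweep V ρ π') :
    L.swapHead hFH (.cons o (.cons o₁' r)) (.cons o' (.cons o₁ r)) =
      (α_ _ _ _).symm ≪≫ whiskerRightIso (L.sq hFH o o₁' o' o₁) (L.comp r) ≪≫ α_ _ _ _ :=
  rfl

theorem swap_nil {F H : G.IntFace} (hFH : F ≠ H) {V : List G.IntFace}
    {π π' : G.DPath G.s G.t} (d : Sweep (F :: H :: V) π π') (d' : Sweep (H :: F :: V) π π') :
    L.swap hFH [] rfl rfl d d' = L.swapHead hFH d d' :=
  rfl

theorem swap_cons {F H X : G.IntFace} (hFH : F ≠ H) {U V l l' : List G.IntFace}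
    (hl : l = U ++ F :: H :: V) (hl' : l' = U ++ H :: F :: V)
    (hm : X :: l = (X :: U) ++ F :: H :: V) (hm' : X :: l' = (X :: U) ++ H :: F :: V)
    {π ρ π' : G.DPath G.s G.t} (o : Occ X π ρ) (d : Sweep l ρ π') (d' : Sweep l' ρ π') :
    L.swap hFH (X :: U) hm hm' (.cons o d) (.cons o d') =
      whiskerLeftIso (L.step o) (L.swap hFH U hl hl' d d') := by
  subst hl hl'
  rfl

theorem swapHead_symm {F H : G.IntFace} (hFH : F ≠ H) {V : List G.IntFace}
    {π π' : G.DPath G.s G.t} (d : Sweep (F :: H :: V) π π') (d' : Sweep (H :: F :: V) π π') :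
    L.swapHead hFH.symm d' d = (L.swapHead hFH d d').symm := by
  cases d with
  | cons o d =>
  cases d with
  | cons o₁' r =>
  cases d' with
  | cons o' d' =>
  cases d' with
  | cons o₁ r' =>
  obtain rfl := corner hFH o o' o₁' o₁
  obtain rfl := Subsingleton.elim r r'
  rw [swapHead_cons, swapHead_cons, ← L.sq_symm hFH]
  refine Iso.ext ?_
  change (α_ _ _ _).inv ≫ (L.sq hFH o o₁' o' o₁).inv ▷ _ ≫ (α_ _ _ _).hom =
    (_ ≫ (L.sq hFH o o₁' o' o₁).inv ▷ _) ≫ _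
  exact (Category.assoc _ _ _).symm

theorem swap_symm {F H : G.IntFace} (hFH : F ≠ H) {V : List G.IntFace} (U : List G.IntFace)
    {l l' : List G.IntFace} (hl : l = U ++ F :: H :: V) (hl' : l' = U ++ H :: F :: V)
    {π π' : G.DPath G.s G.t} (d : Sweep l π π') (d' : Sweep l' π π') :
    L.swap hFH.symm U hl' hl d' d = (L.swap hFH U hl hl' d d').symm := by
  induction U generalizing l l' π with
  | nil =>
    subst hl hl'
    exact L.swapHead_symm hFH d d'
  | cons X U ih =>
    subst hl hl'
    cases d with
    | cons o d =>
    cases d' with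
    | cons o' d' =>
    obtain rfl := o.target_eq o'
    obtain rfl := Subsingleton.elim o o'
    rw [L.swap_cons hFH rfl rfl, L.swap_cons hFH.symm rfl rfl, ih]
    rfl

theorem swap_comm {F H I J : G.IntFace} (hFH : F ≠ H) (hIJ : I ≠ J) (U V W : List G.IntFace)
    {lx ly lz lw : List G.IntFace} (hx : lx = U ++ F :: H :: (V ++ I :: J :: W))
    (hy : ly = U ++ H :: F :: (V ++ I :: J :: W)) (hz : lz = U ++ F :: H :: (V ++ J :: I :: W))
    (hw : lw = U ++ H :: F :: (V ++ J :: I :: W))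
    (hx' : lx = (U ++ F :: H :: V) ++ I :: J :: W) (hy' : ly = (U ++ H :: F :: V) ++ I :: J :: W)
    (hz' : lz = (U ++ F :: H :: V) ++ J :: I :: W) (hw' : lw = (U ++ H :: F :: V) ++ J :: I :: W)
    {π π' : G.DPath G.s G.t} (dx : Sweep lx π π') (dy : Sweep ly π π') (dz : Sweep lz π π')
    (dw : Sweep lw π π') :
    (L.swap hFH U hx hy dx dy).hom ≫ (L.swap hIJ _ hy' hw' dy dw).hom =
      (L.swap hIJ _ hx' hz' dx dz).hom ≫ (L.swap hFH U hz hw dz dw).hom := by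
  induction U generalizing lx ly lz lw π with
  | nil =>
    subst hx hy hz hw
    cases dx with
    | cons o dx =>
    cases dx with
    | cons o₁' rx =>
    cases dy with
    | cons o' dy =>
    cases dy with
    | cons o₁ ry =>
    obtain rfl := corner hFH o o' o₁' o₁
    obtain rfl := Subsingleton.elim rx ry
    cases dz with
    | cons p dz =>
    cases dz with
    | cons p₁' rz =>
    obtain rfl := o.target_eq p
    obtain rfl := Subsingleton.elim o p
    obtain rfl := o₁'.target_eq p₁'
    obtain rfl := Subsingleton.elim o₁' p₁'
    cases dw with
    | cons q dw =>
    cases dw with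
    | cons q₁ rv =>
    obtain rfl := o'.target_eq q
    obtain rfl := Subsingleton.elim o' q
    obtain rfl := o₁.target_eq q₁
    obtain rfl := Subsingleton.elim o₁ q₁
    obtain rfl := Subsingleton.elim rv rz
    change ((α_ _ _ _).inv ≫ (L.sq hFH o o₁' o' o₁).hom ▷ L.comp rx ≫ (α_ _ _ _).hom) ≫
        L.step o' ◁ L.step o₁ ◁ (L.swap hIJ V rfl rfl rx rv).hom =
      (L.step o ◁ L.step o₁' ◁ (L.swap hIJ V rfl rfl rx rv).hom) ≫
        ((α_ _ _ _).inv ≫ (L.sq hFH o o₁' o' o₁).hom ▷ L.comp rv ≫ (α_ _ _ _).hom)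
    generalize (L.swap hIJ V rfl rfl rx rv).hom = s
    simp only [Category.assoc]
    rw [← associator_naturality_right, ← whisker_exchange_assoc, associator_inv_naturality_right_assoc]
  | cons X U ih =>
    subst hx hy hz hw
    cases dx with
    | cons o dx =>
    cases dy with
    | cons oy dy =>
    cases dz with
    | cons oz dz =>
    cases dw with
    | cons ow dw =>
    obtain rfl := o.target_eq oy
    obtain rfl := o.target_eq oz
    obtain rfl := o.target_eq ow
    obtain rfl := Subsingleton.elim o oy
    obtain rfl := Subsingleton.elim o oz
    obtain rfl := Subsingleton.elim o ow
    have k₁ := (List.cons.inj hx').2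
    have k₂ := (List.cons.inj hy').2
    have k₃ := (List.cons.inj hz').2
    have k₄ := (List.cons.inj hw').2
    have := ih rfl rfl rfl rfl k₁ k₂ k₃ k₄ dx dy dz dw
    have e₁ := congrArg Iso.hom (L.swap_cons hFH rfl rfl rfl rfl o dx dy)
    have e₂ := congrArg Iso.hom (L.swap_cons hIJ k₂ k₄ hy' hw' o dy dw)
    have e₃ := congrArg Iso.hom (L.swap_cons hIJ k₁ k₃ hx' hz' o dx dz)
    have e₄ := congrArg Iso.hom (L.swap_cons hFH rfl rfl rfl rfl o dz dw)
    refine (congrArg₂ (· ≫ ·) e₁ e₂).trans (Eq.trans ?_ (congrArg₂ (· ≫ ·) e₃ e₄).symm)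
    change L.step o ◁ _ ≫ L.step o ◁ _ = L.step o ◁ _ ≫ L.step o ◁ _
    rw [← Bicategory.whiskerLeft_comp, ← Bicategory.whiskerLeft_comp]
    exact congrArg _ this

end Labelling

theorem hex_swap₁₂ {B : Type*} [Bicategory B] {p a b c ab ac bc r : B}
    {A : p ⟶ a} {A₁ : b ⟶ ab} {A₂ : c ⟶ ac} {A₃ : bc ⟶ r}
    {B : p ⟶ b} {B₁ : a ⟶ ab} {B₂ : c ⟶ bc} {B₃ : ac ⟶ r}
    {C : p ⟶ c} {C₁ : a ⟶ ac} {C₂ : b ⟶ bc} {C₃ : ab ⟶ r}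
    {x : A ≫ B₁ ≅ B ≫ A₁} {y : A₁ ≫ C₃ ≅ C₂ ≫ A₃} {z : B ≫ C₂ ≅ C ≫ B₂}
    {x' : A₂ ≫ B₃ ≅ B₂ ≫ A₃} {y' : A ≫ C₁ ≅ C ≫ A₂} {z' : B₁ ≫ C₃ ≅ C₁ ≫ B₃}
    (h : x.hom ▷ C₃ ≫ (α_ _ _ _).hom ≫ B ◁ y.hom ≫ (α_ _ _ _).inv ≫ z.hom ▷ A₃ =
      (α_ _ _ _).hom ≫ A ◁ z'.hom ≫ (α_ _ _ _).inv ≫ y'.hom ▷ B₃ ≫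
        (α_ _ _ _).hom ≫ C ◁ x'.hom ≫ (α_ _ _ _).inv) :
    x.inv ▷ C₃ ≫ (α_ _ _ _).hom ≫ A ◁ z'.hom ≫ (α_ _ _ _).inv ≫ y'.hom ▷ B₃ =
      (α_ _ _ _).hom ≫ B ◁ y.hom ≫ (α_ _ _ _).inv ≫ z.hom ▷ A₃ ≫
        (α_ _ _ _).hom ≫ C ◁ x'.inv ≫ (α_ _ _ _).inv := by
  rw [← cancel_epi (x.hom ▷ C₃)]
  have h := congrArg (· ≫ (α_ _ _ _).hom ≫ C ◁ x'.inv ≫ (α_ _ _ _).inv) h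
  simp only [Category.assoc] at h
  rw [h]
  simp

theorem hex_swap₂₃ {B : Type*} [Bicategory B] {p a b c ab ac bc r : B}
    {A : p ⟶ a} {A₁ : b ⟶ ab} {A₂ : c ⟶ ac} {A₃ : bc ⟶ r}
    {B : p ⟶ b} {B₁ : a ⟶ ab} {B₂ : c ⟶ bc} {B₃ : ac ⟶ r}
    {C : p ⟶ c} {C₁ : a ⟶ ac} {C₂ : b ⟶ bc} {C₃ : ab ⟶ r}
    {x : A ≫ B₁ ≅ B ≫ A₁} {y : A₁ ≫ C₃ ≅ C₂ ≫ A₃} {z : B ≫ C₂ ≅ C ≫ B₂}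
    {x' : A₂ ≫ B₃ ≅ B₂ ≫ A₃} {y' : A ≫ C₁ ≅ C ≫ A₂} {z' : B₁ ≫ C₃ ≅ C₁ ≫ B₃}
    (h : x.hom ▷ C₃ ≫ (α_ _ _ _).hom ≫ B ◁ y.hom ≫ (α_ _ _ _).inv ≫ z.hom ▷ A₃ =
      (α_ _ _ _).hom ≫ A ◁ z'.hom ≫ (α_ _ _ _).inv ≫ y'.hom ▷ B₃ ≫
        (α_ _ _ _).hom ≫ C ◁ x'.hom ≫ (α_ _ _ _).inv) :
    y'.hom ▷ B₃ ≫ (α_ _ _ _).hom ≫ C ◁ x'.hom ≫ (α_ _ _ _).inv ≫ z.inv ▷ A₃ =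
      (α_ _ _ _).hom ≫ A ◁ z'.inv ≫ (α_ _ _ _).inv ≫ x.hom ▷ C₃ ≫
        (α_ _ _ _).hom ≫ B ◁ y.hom ≫ (α_ _ _ _).inv := by
  rw [← cancel_epi ((α_ _ _ _).hom ≫ A ◁ z'.hom ≫ (α_ _ _ _).inv)]
  have h := congrArg (· ≫ z.inv ▷ A₃) h
  simp only [Category.assoc] at h
  simp only [Category.assoc]
  rw [← h]
  simp

theorem hex_whisker {B : Type*} [Bicategory B] {p a b c ab ac bc r q : B}
    {A : p ⟶ a} {A₁ : b ⟶ ab} {A₂ : c ⟶ ac} {A₃ : bc ⟶ r}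
    {B : p ⟶ b} {B₁ : a ⟶ ab} {B₂ : c ⟶ bc} {B₃ : ac ⟶ r}
    {C : p ⟶ c} {C₁ : a ⟶ ac} {C₂ : b ⟶ bc} {C₃ : ab ⟶ r}
    {x : A ≫ B₁ ⟶ B ≫ A₁} {y : A₁ ≫ C₃ ⟶ C₂ ≫ A₃} {z : B ≫ C₂ ⟶ C ≫ B₂}
    {x' : A₂ ≫ B₃ ⟶ B₂ ≫ A₃} {y' : A ≫ C₁ ⟶ C ≫ A₂} {z' : B₁ ≫ C₃ ⟶ C₁ ≫ B₃}
    (h : x ▷ C₃ ≫ (α_ _ _ _).hom ≫ B ◁ y ≫ (α_ _ _ _).inv ≫ z ▷ A₃ =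
      (α_ _ _ _).hom ≫ A ◁ z' ≫ (α_ _ _ _).inv ≫ y' ▷ B₃ ≫
        (α_ _ _ _).hom ≫ C ◁ x' ≫ (α_ _ _ _).inv) (D : r ⟶ q) :
    ((α_ _ _ _).inv ≫ x ▷ (C₃ ≫ D) ≫ (α_ _ _ _).hom) ≫
        (B ◁ ((α_ _ _ _).inv ≫ y ▷ D ≫ (α_ _ _ _).hom)) ≫
        ((α_ _ _ _).inv ≫ z ▷ (A₃ ≫ D) ≫ (α_ _ _ _).hom) =
      (A ◁ ((α_ _ _ _).inv ≫ z' ▷ D ≫ (α_ _ _ _).hom)) ≫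
        ((α_ _ _ _).inv ≫ y' ▷ (B₃ ≫ D) ≫ (α_ _ _ _).hom) ≫
        (C ◁ ((α_ _ _ _).inv ≫ x' ▷ D ≫ (α_ _ _ _).hom)) := by
  calc _ = A ◁ (α_ _ _ _).inv ≫ (α_ _ _ _).inv ≫ (α_ _ _ _).inv ▷ D ≫
        ((x ▷ C₃ ≫ (α_ _ _ _).hom ≫ B ◁ y ≫ (α_ _ _ _).inv ≫ z ▷ A₃) ▷ D) ≫
        (α_ _ _ _).hom ▷ D ≫ (α_ _ _ _).hom ≫ C ◁ (α_ _ _ _).hom := by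
        simp only [comp_whiskerRight, whisker_assoc, whiskerRight_comp, whiskerLeft_comp]
        bicategory
    _ = _ := by
        rw [h]
        bicategory

namespace PastingScheme

variable {G : PastingScheme.{u}}

theorem Occ.pre_post {a b : G.Vertex} {F : G.IntFace} {π ρ : G.DPath a b} (o : Occ F π ρ)
    {x : G.DPath a (fs F)} {y : G.DPath (ft F) b} (h : π = x.comp ((upper F).comp y)) :
    o.pre = x ∧ o.post = y :=
  o.pre_post_eq ⟨x, y, h, rfl⟩

theorem Between.lt {a b : G.Vertex} {F H : G.IntFace} {π π₁ π₂ : G.DPath a b} {o : Occ F π π₁}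
    {o' : Occ H π π₂} (z : Between o o') : o.pre.length < o'.pre.length := by
  obtain ⟨e, he⟩ := exists_upper_edge F
  have := length_pos _ e he
  rw [z.pre_eq]
  simp only [Quiver.Path.length_comp]
  omega

end PastingScheme

namespace Labelling

variable {G : PastingScheme.{u}} {K : Type*} [GrayCategory K] (L : Labelling G K)

theorem step_ext {a u b : G.Vertex} {F : G.IntFace} {π ρ : G.DPath a b} {π' ρ' : G.DPath u b}
    (o : Occ F π ρ) (o' : Occ F π' ρ') {q : G.DPath a u} (hq : o.pre = q.comp o'.pre)
    (hp : o.post = o'.post) {f : L.cells.obj a ⟶ L.cells.obj u} (hf : L.path q = f) :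
    L.step o ≍ wl f (L.step o') := by
  subst hf
  refine (L.step_heq' o hq hp).trans (HEq.trans ?_ (HEq.trans (comp_wl (L.path q) (L.path o'.pre)
    (wr (L.face F) (L.path o'.post))) ?_))
  · exact wl_heq (L.path_comp _ _) rfl rfl HEq.rfl
  · exact wl_heq rfl ((congrArg L.path o'.eq_upper).trans (L.path_comp₃ _ _ _)).symm
      ((congrArg L.path o'.eq_lower).trans (L.path_comp₃ _ _ _)).symm (L.step_heq o').symm

theorem sqAux_heq_γ {a b : G.Vertex} {F H : G.IntFace} {π π₁ π₂ ρ : G.DPath a b}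
    {o : Occ F π π₁} {o₁' : Occ H π₁ ρ} {o' : Occ H π π₂} {o₁ : Occ F π₂ ρ} (z : Between o o')
    {x : G.DPath a (fs F)} (hx : o.pre = x) {π' ρ' : G.DPath (ft F) b} (s : Occ H π' ρ')
    (hm : s.pre = z.mid) (hp : s.post = o'.post) :
    (L.sqAux z (o₁' := o₁') (o₁ := o₁)).hom ≍ (γ (wl (L.path x) (L.face F)) (L.step s)).hom := by
  subst hx
  refine (L.sqAux_heq z).trans ?_
  have hu := (congrArg L.path s.eq_upper).trans (L.path_comp₃ _ _ _)
  have hl := (congrArg L.path s.eq_lower).trans (L.path_comp₃ _ _ _)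
  rw [hm, hp] at hu hl
  exact γ_heq rfl rfl hu.symm hl.symm HEq.rfl (L.step_heq' s hm hp).symm

theorem sqAux_ext {a u b : G.Vertex} {F H : G.IntFace} {π π₁ π₂ ρ : G.DPath a b}
    {o : Occ F π π₁} {o₁' : Occ H π₁ ρ} {o' : Occ H π π₂} {o₁ : Occ F π₂ ρ} (z : Between o o')
    {θ θ₁ θ₂ κ : G.DPath u b} {s : Occ F θ θ₁} {s₁' : Occ H θ₁ κ} {s' : Occ H θ θ₂}
    {s₁ : Occ F θ₂ κ} (w : Between s s') {q : G.DPath a u} (hq : o.pre = q.comp s.pre)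
    (hm : z.mid = w.mid) (hp : o'.post = s'.post) {f : L.cells.obj a ⟶ L.cells.obj u}
    (hf : L.path q = f) :
    (L.sqAux z (o₁' := o₁') (o₁ := o₁)).hom ≍
      wl₃ f (L.sqAux w (o₁' := s₁') (o₁ := s₁)).hom := by
  subst hf
  have h₀ := (congrArg L.path w.eq_source).trans (L.path_comp₅ _ _ _ _ _)
  have h₁ := (congrArg L.path w.eq_left).trans (L.path_comp₅ _ _ _ _ _)
  have h₂ := (congrArg L.path w.eq_right).trans (L.path_comp₅ _ _ _ _ _)
  have h₃ := (congrArg L.path (w.eq_target s₁')).trans (L.path_comp₅ _ _ _ _ _)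
  have e : L.path o.pre = L.path q ≫ L.path s.pre := by rw [hq, path_comp]
  refine (L.sqAux_heq z).trans (HEq.trans ?_ ((γ_wl _ _ _).trans
    (wl₃_heq rfl h₀ h₃ (comp_heq' h₀ h₁ h₃ (L.step_left_heq s s' w) (L.step_second_heq s₁' w))
      (comp_heq' h₀ h₂ h₃ (L.step_right_heq s s' w) (L.step_first_heq s₁ w))
      (L.sqAux_heq w)).symm))
  refine γ_heq ?_ ?_ ?_ ?_ ?_ ?_
  · rw [e, Category.assoc]
  · rw [e, Category.assoc]
  · rw [hm, hp]
  · rw [hm, hp]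
  · exact (wl_heq e rfl rfl HEq.rfl).trans (comp_wl _ _ _)
  · rw [hm, hp]

theorem hex_sorted {a b : G.Vertex} {A B C : G.IntFace} (hAB : A ≠ B) (hAC : A ≠ C) (hBC : B ≠ C)
    {p pa pb pc ab ac bc r : G.DPath a b}
    (A₀ : Occ A p pa) (A₁ : Occ A pb ab) (A₂ : Occ A pc ac) (A₃ : Occ A bc r)
    (B₀ : Occ B p pb) (B₁ : Occ B pa ab) (B₂ : Occ B pc bc) (B₃ : Occ B ac r)
    (C₀ : Occ C p pc) (C₁ : Occ C pa ac) (C₂ : Occ C pb bc) (C₃ : Occ C ab r)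
    (z₁ : Between A₀ B₀) (z₂ : Between B₀ C₀) :
    (L.sq hAB A₀ B₁ B₀ A₁).hom ▷ L.step C₃ ≫ (α_ _ _ _).hom ≫
        L.step B₀ ◁ (L.sq hAC A₁ C₃ C₂ A₃).hom ≫ (α_ _ _ _).inv ≫
          (L.sq hBC B₀ C₂ C₀ B₂).hom ▷ L.step A₃ =
      (α_ _ _ _).hom ≫ L.step A₀ ◁ (L.sq hBC B₁ C₃ C₁ B₃).hom ≫ (α_ _ _ _).inv ≫
        (L.sq hAC A₀ C₁ C₀ A₂).hom ▷ L.step B₃ ≫ (α_ _ _ _).hom ≫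
          L.step C₀ ◁ (L.sq hAB A₂ B₃ B₂ A₃).hom ≫ (α_ _ _ _).inv := by
  have w₁ := z₁.eq_source
  obtain ⟨m, h₁, h₂⟩ := z₁
  obtain ⟨n, h₃, h₄⟩ := z₂
  obtain ⟨hA, hA'⟩ : A₀.pre = A₀.pre ∧ A₀.post = m.comp ((upper B).comp (n.comp ((upper C).comp C₀.post))) := by
    rw [← h₃]; exact ⟨rfl, h₁⟩
  have hB : B₀.pre = A₀.pre.comp ((upper A).comp m) := h₂
  have hB' : B₀.post = n.comp ((upper C).comp C₀.post) := h₃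
  have hC : C₀.pre = A₀.pre.comp ((upper A).comp (m.comp ((upper B).comp n))) := by
    rw [h₄, h₂]; simp only [Quiver.Path.comp_assoc]
  obtain ⟨y, hy⟩ : ∃ y, C₀.post = y := ⟨_, rfl⟩
  obtain ⟨x, hx⟩ : ∃ x, A₀.pre = x := ⟨_, rfl⟩
  rw [hy] at hA' hB'
  rw [hx] at hB hC
  have ea := A₀.eq_lower
  have eb := B₀.eq_lower
  have ec := C₀.eq_lower
  rw [hx, hA'] at ea
  rw [hB, hB'] at eb
  rw [hC, hy] at ec
  simp only [Quiver.Path.comp_assoc] at ea eb ec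
  obtain ⟨hA₁, hA₁'⟩ := A₁.pre_post (x := x) (y := m.comp ((lower B).comp (n.comp
    ((upper C).comp y)))) eb
  obtain ⟨hA₂, hA₂'⟩ := A₂.pre_post (x := x) (y := m.comp ((upper B).comp (n.comp
    ((lower C).comp y)))) ec
  obtain ⟨hB₁, hB₁'⟩ := B₁.pre_post (x := x.comp ((lower A).comp m))
    (y := n.comp ((upper C).comp y)) (by rw [ea]; simp only [Quiver.Path.comp_assoc])
  obtain ⟨hB₂, hB₂'⟩ := B₂.pre_post (x := x.comp ((upper A).comp m))
    (y := n.comp ((lower C).comp y)) (by rw [ec]; simp only [Quiver.Path.comp_assoc])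
  obtain ⟨hC₁, hC₁'⟩ := C₁.pre_post (x := x.comp ((lower A).comp (m.comp ((upper B).comp n))))
    (y := y) (by rw [ea]; simp only [Quiver.Path.comp_assoc])
  obtain ⟨hC₂, hC₂'⟩ := C₂.pre_post (x := x.comp ((upper A).comp (m.comp ((lower B).comp n))))
    (y := y) (by rw [eb]; simp only [Quiver.Path.comp_assoc])
  have eab := A₁.eq_lower
  have eac := A₂.eq_lower
  have ebc := B₂.eq_lower
  rw [hA₁, hA₁'] at eab
  rw [hA₂, hA₂'] at eac
  rw [hB₂, hB₂'] at ebc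
  simp only [Quiver.Path.comp_assoc] at ebc
  obtain ⟨hA₃, hA₃'⟩ := A₃.pre_post (x := x) (y := m.comp ((lower B).comp (n.comp
    ((lower C).comp y)))) ebc
  obtain ⟨hB₃, hB₃'⟩ := B₃.pre_post (x := x.comp ((lower A).comp m))
    (y := n.comp ((lower C).comp y)) (by rw [eac]; simp only [Quiver.Path.comp_assoc])
  obtain ⟨hC₃, hC₃'⟩ := C₃.pre_post (x := x.comp ((lower A).comp (m.comp ((lower B).comp n))))
    (y := y) (by rw [eab]; simp only [Quiver.Path.comp_assoc])
  have er := A₃.eq_lower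
  rw [hA₃, hA₃'] at er
  have ep := A₀.eq_upper
  rw [hx, hA'] at ep
  -- the occurrences of `B` and `C` in the part of the path after `A`
  let S₀ : Occ B (m.comp ((upper B).comp (n.comp ((upper C).comp y))))
      (m.comp ((lower B).comp (n.comp ((upper C).comp y)))) := ⟨m, _, rfl, rfl⟩
  let S₁ : Occ B (m.comp ((upper B).comp (n.comp ((lower C).comp y))))
      (m.comp ((lower B).comp (n.comp ((lower C).comp y)))) := ⟨m, _, rfl, rfl⟩
  let T₀ : Occ C (m.comp ((upper B).comp (n.comp ((upper C).comp y))))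
      (m.comp ((upper B).comp (n.comp ((lower C).comp y)))) :=
    ⟨m.comp ((upper B).comp n), y, by simp only [Quiver.Path.comp_assoc],
      by simp only [Quiver.Path.comp_assoc]⟩
  let T₁ : Occ C (m.comp ((lower B).comp (n.comp ((upper C).comp y))))
      (m.comp ((lower B).comp (n.comp ((lower C).comp y)))) :=
    ⟨m.comp ((lower B).comp n), y, by simp only [Quiver.Path.comp_assoc],
      by simp only [Quiver.Path.comp_assoc]⟩
  let w : Between S₀ T₀ := ⟨n, rfl, rfl⟩
  have hf : L.path (x.comp (upper A)) = L.path x ≫ L.path (upper A) := L.path_comp _ _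
  have hf' : L.path (x.comp (lower A)) = L.path x ≫ L.path (lower A) := L.path_comp _ _
  have as {u v : G.Vertex} (q : G.DPath (fs A) u) (q' : G.DPath u v) :
    x.comp (q.comp q') = (x.comp q).comp q' := by simp only [Quiver.Path.comp_assoc]
  rw [L.sq_eq hAB A₀ B₁ B₀ A₁ ⟨m, by rw [hA', hB'], by rw [hB, hx]⟩,
    L.sq_eq hAC A₁ C₃ C₂ A₃ ⟨m.comp ((lower B).comp n),
      by rw [hA₁', hC₂']; simp only [Quiver.Path.comp_assoc], by rw [hC₂, hA₁]⟩,
    L.sq_eq hBC B₀ C₂ C₀ B₂ ⟨n, by rw [hB', hy], by rw [hC, hB]; simp only [Quiver.Path.comp_assoc]⟩,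
    L.sq_eq hBC B₁ C₃ C₁ B₃ ⟨n, by rw [hB₁', hC₁'],
      by rw [hC₁, hB₁]; simp only [Quiver.Path.comp_assoc]⟩,
    L.sq_eq hAC A₀ C₁ C₀ A₂ ⟨m.comp ((upper B).comp n),
      by rw [hA', hy]; simp only [Quiver.Path.comp_assoc], by rw [hC, hx]⟩,
    L.sq_eq hAB A₂ B₃ B₂ A₃ ⟨m, by rw [hA₂', hB₂'], by rw [hB₂, hA₂]⟩]
  have ex {u : G.Vertex} {q : G.DPath u b} {σ : G.DPath (fs A) u} {π : G.DPath a b}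
      (h : π = x.comp (σ.comp q)) : L.path π = (L.path x ≫ L.path σ) ≫ L.path q := by
    rw [h, path_comp₃, Category.assoc]
  exact hexagon' (wl (L.path x) (L.face A)) (L.step S₀) (L.step T₁) (L.step T₀) (L.step S₁)
    (L.sqAux w (o₁' := T₁) (o₁ := S₁)).hom (ex ep) (ex ea) (ex eb) (ex ec) (ex eab) (ex eac)
    (ex ebc) (ex er) (L.step_heq_wr A₀ hx hA') (L.step_heq_wr A₁ hA₁ hA₁')
    (L.step_heq_wr A₂ hA₂ hA₂') (L.step_heq_wr A₃ hA₃ hA₃')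
    (L.step_ext B₀ S₀ (hB.trans (as _ _)) hB' hf) (L.step_ext B₁ S₀ (hB₁.trans (as _ _)) hB₁' hf')
    (L.step_ext B₂ S₁ (hB₂.trans (as _ _)) hB₂' hf) (L.step_ext B₃ S₁ (hB₃.trans (as _ _)) hB₃' hf')
    (L.step_ext C₀ T₀ (hC.trans (as _ _)) hy hf) (L.step_ext C₁ T₀ (hC₁.trans (as _ _)) hC₁' hf')
    (L.step_ext C₂ T₁ (hC₂.trans (as _ _)) hC₂' hf) (L.step_ext C₃ T₁ (hC₃.trans (as _ _)) hC₃' hf')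
    (L.sqAux_heq_γ _ hx S₀ rfl hB'.symm) (L.sqAux_heq_γ _ hA₁ T₁ rfl hC₂'.symm)
    (L.sqAux_ext _ w (hB.trans (as _ _)) rfl hy hf) (L.sqAux_heq_γ _ hA₂ S₁ rfl hB₂'.symm)
    (L.sqAux_heq_γ _ hx T₀ rfl hy.symm) (L.sqAux_ext _ w (hB₁.trans (as _ _)) rfl hC₁' hf')

theorem sq_inv {a b : G.Vertex} {F H : G.IntFace} (hFH : F ≠ H) {π π₁ π₂ ρ : G.DPath a b}
    (o : Occ F π π₁) (o₁' : Occ H π₁ ρ) (o' : Occ H π π₂) (o₁ : Occ F π₂ ρ) :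
    (L.sq hFH o o₁' o' o₁).inv = (L.sq hFH.symm o' o₁ o o₁').hom :=
  congrArg Iso.hom (L.sq_symm hFH o o₁' o' o₁)

/-- The hexagon of interchange isomorphisms for three faces of one path. -/
def Hex {a b : G.Vertex} {A B C : G.IntFace} (hAB : A ≠ B) (hAC : A ≠ C) (hBC : B ≠ C)
    {p pa pb pc ab ac bc r : G.DPath a b}
    (A₀ : Occ A p pa) (A₁ : Occ A pb ab) (A₂ : Occ A pc ac) (A₃ : Occ A bc r)
    (B₀ : Occ B p pb) (B₁ : Occ B pa ab) (B₂ : Occ B pc bc) (B₃ : Occ B ac r)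
    (C₀ : Occ C p pc) (C₁ : Occ C pa ac) (C₂ : Occ C pb bc) (C₃ : Occ C ab r) : Prop :=
    (L.sq hAB A₀ B₁ B₀ A₁).hom ▷ L.step C₃ ≫ (α_ _ _ _).hom ≫
        L.step B₀ ◁ (L.sq hAC A₁ C₃ C₂ A₃).hom ≫ (α_ _ _ _).inv ≫
          (L.sq hBC B₀ C₂ C₀ B₂).hom ▷ L.step A₃ =
      (α_ _ _ _).hom ≫ L.step A₀ ◁ (L.sq hBC B₁ C₃ C₁ B₃).hom ≫ (α_ _ _ _).inv ≫
        (L.sq hAC A₀ C₁ C₀ A₂).hom ▷ L.step B₃ ≫ (α_ _ _ _).hom ≫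
          L.step C₀ ◁ (L.sq hAB A₂ B₃ B₂ A₃).hom ≫ (α_ _ _ _).inv

theorem Hex.swap₁₂ {a b : G.Vertex} {A B C : G.IntFace} (hAB : A ≠ B) (hAC : A ≠ C) (hBC : B ≠ C)
    {p pa pb pc ab ac bc r : G.DPath a b}
    (A₀ : Occ A p pa) (A₁ : Occ A pb ab) (A₂ : Occ A pc ac) (A₃ : Occ A bc r)
    (B₀ : Occ B p pb) (B₁ : Occ B pa ab) (B₂ : Occ B pc bc) (B₃ : Occ B ac r)
    (C₀ : Occ C p pc) (C₁ : Occ C pa ac) (C₂ : Occ C pb bc) (C₃ : Occ C ab r)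
    (h : L.Hex hAB hAC hBC A₀ A₁ A₂ A₃ B₀ B₁ B₂ B₃ C₀ C₁ C₂ C₃) :
    L.Hex hAB.symm hBC hAC B₀ B₁ B₂ B₃ A₀ A₁ A₂ A₃ C₀ C₂ C₁ C₃ := by
  have := hex_swap₁₂ (x := L.sq hAB A₀ B₁ B₀ A₁) (y := L.sq hAC A₁ C₃ C₂ A₃)
    (z := L.sq hBC B₀ C₂ C₀ B₂) (x' := L.sq hAB A₂ B₃ B₂ A₃) (y' := L.sq hAC A₀ C₁ C₀ A₂)
    (z' := L.sq hBC B₁ C₃ C₁ B₃) h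
  rw [L.sq_inv hAB, L.sq_inv hAB] at this
  exact this

theorem Hex.swap₂₃ {a b : G.Vertex} {A B C : G.IntFace} (hAB : A ≠ B) (hAC : A ≠ C) (hBC : B ≠ C)
    {p pa pb pc ab ac bc r : G.DPath a b}
    (A₀ : Occ A p pa) (A₁ : Occ A pb ab) (A₂ : Occ A pc ac) (A₃ : Occ A bc r)
    (B₀ : Occ B p pb) (B₁ : Occ B pa ab) (B₂ : Occ B pc bc) (B₃ : Occ B ac r)
    (C₀ : Occ C p pc) (C₁ : Occ C pa ac) (C₂ : Occ C pb bc) (C₃ : Occ C ab r)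
    (h : L.Hex hAB hAC hBC A₀ A₁ A₂ A₃ B₀ B₁ B₂ B₃ C₀ C₁ C₂ C₃) :
    L.Hex hAC hAB hBC.symm A₀ A₂ A₁ A₃ C₀ C₁ C₂ C₃ B₀ B₁ B₂ B₃ := by
  have := hex_swap₂₃ (x := L.sq hAB A₀ B₁ B₀ A₁) (y := L.sq hAC A₁ C₃ C₂ A₃)
    (z := L.sq hBC B₀ C₂ C₀ B₂) (x' := L.sq hAB A₂ B₃ B₂ A₃) (y' := L.sq hAC A₀ C₁ C₀ A₂)
    (z' := L.sq hBC B₁ C₃ C₁ B₃) h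
  rw [L.sq_inv hBC, L.sq_inv hBC] at this
  exact this

theorem hex {a b : G.Vertex} {A B C : G.IntFace} (hAB : A ≠ B) (hAC : A ≠ C) (hBC : B ≠ C)
    {p pa pb pc ab ac bc r : G.DPath a b}
    (A₀ : Occ A p pa) (A₁ : Occ A pb ab) (A₂ : Occ A pc ac) (A₃ : Occ A bc r)
    (B₀ : Occ B p pb) (B₁ : Occ B pa ab) (B₂ : Occ B pc bc) (B₃ : Occ B ac r)
    (C₀ : Occ C p pc) (C₁ : Occ C pa ac) (C₂ : Occ C pb bc) (C₃ : Occ C ab r) :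
    L.Hex hAB hAC hBC A₀ A₁ A₂ A₃ B₀ B₁ B₂ B₃ C₀ C₁ C₂ C₃ := by
  rcases between_total hAB A₀ B₀ with ⟨⟨z₁⟩⟩ | ⟨⟨z₁⟩⟩ <;>
  rcases between_total hBC B₀ C₀ with ⟨⟨z₂⟩⟩ | ⟨⟨z₂⟩⟩ <;>
  rcases between_total hAC A₀ C₀ with ⟨⟨z₃⟩⟩ | ⟨⟨z₃⟩⟩
  · exact L.hex_sorted hAB hAC hBC A₀ A₁ A₂ A₃ B₀ B₁ B₂ B₃ C₀ C₁ C₂ C₃ z₁ z₂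
  · have := z₁.lt; have := z₂.lt; have := z₃.lt; omega
  · -- A < C < B
    exact Hex.swap₂₃ L hAC hAB hBC.symm A₀ A₂ A₁ A₃ C₀ C₁ C₂ C₃ B₀ B₁ B₂ B₃
      (L.hex_sorted hAC hAB hBC.symm A₀ A₂ A₁ A₃ C₀ C₁ C₂ C₃ B₀ B₁ B₂ B₃ z₃ z₂)
  · -- C < A < B
    exact Hex.swap₂₃ L hAC hAB hBC.symm A₀ A₂ A₁ A₃ C₀ C₁ C₂ C₃ B₀ B₁ B₂ B₃
      (Hex.swap₁₂ L hAC.symm hBC.symm hAB C₀ C₁ C₂ C₃ A₀ A₂ A₁ A₃ B₀ B₂ B₁ B₃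
        (L.hex_sorted hAC.symm hBC.symm hAB C₀ C₁ C₂ C₃ A₀ A₂ A₁ A₃ B₀ B₂ B₁ B₃ z₃ z₁))
  · -- B < A < C
    exact Hex.swap₁₂ L hAB.symm hBC hAC B₀ B₁ B₂ B₃ A₀ A₁ A₂ A₃ C₀ C₂ C₁ C₃
      (L.hex_sorted hAB.symm hBC hAC B₀ B₁ B₂ B₃ A₀ A₁ A₂ A₃ C₀ C₂ C₁ C₃ z₁ z₃)
  · -- B < C < A
    exact Hex.swap₁₂ L hAB.symm hBC hAC B₀ B₁ B₂ B₃ A₀ A₁ A₂ A₃ C₀ C₂ C₁ C₃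
      (Hex.swap₂₃ L hBC hAB.symm hAC.symm B₀ B₂ B₁ B₃ C₀ C₂ C₁ C₃ A₀ A₁ A₂ A₃
        (L.hex_sorted hBC hAB.symm hAC.symm B₀ B₂ B₁ B₃ C₀ C₂ C₁ C₃ A₀ A₁ A₂ A₃ z₂ z₃))
  · have := z₁.lt; have := z₂.lt; have := z₃.lt; omega
  · -- C < B < A
    exact Hex.swap₂₃ L hAC hAB hBC.symm A₀ A₂ A₁ A₃ C₀ C₁ C₂ C₃ B₀ B₁ B₂ B₃
      (Hex.swap₁₂ L hAC.symm hBC.symm hAB C₀ C₁ C₂ C₃ A₀ A₂ A₁ A₃ B₀ B₂ B₁ B₃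
        (Hex.swap₂₃ L hBC.symm hAC.symm hAB.symm C₀ C₂ C₁ C₃ B₀ B₂ B₁ B₃ A₀ A₂ A₁ A₃
          (L.hex_sorted hBC.symm hAC.symm hAB.symm C₀ C₂ C₁ C₃ B₀ B₂ B₁ B₃ A₀ A₂ A₁ A₃ z₂ z₁)))

end Labelling

namespace Labelling

variable {G : PastingScheme.{u}} {K : Type*} [GrayCategory K] (L : Labelling G K)

theorem swap_hexagon {A B C : G.IntFace} (hAB : A ≠ B) (hAC : A ≠ C) (hBC : B ≠ C)
    (U V : List G.IntFace) {l₁ l₂ l₃ m₂ m₃ l : List G.IntFace}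
    (h₁ : l₁ = U ++ A :: B :: C :: V) (h₂ : l₂ = U ++ B :: A :: C :: V)
    (h₃ : l₃ = U ++ B :: C :: A :: V) (k₂ : m₂ = U ++ A :: C :: B :: V)
    (k₃ : m₃ = U ++ C :: A :: B :: V) (h : l = U ++ C :: B :: A :: V)
    (h₂' : l₂ = (U ++ [B]) ++ A :: C :: V) (h₃' : l₃ = (U ++ [B]) ++ C :: A :: V)
    (h₁' : l₁ = (U ++ [A]) ++ B :: C :: V) (k₂' : m₂ = (U ++ [A]) ++ C :: B :: V)
    (k₃' : m₃ = (U ++ [C]) ++ A :: B :: V) (h' : l = (U ++ [C]) ++ B :: A :: V)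
    {π π' : G.DPath G.s G.t} (d₁ : Sweep l₁ π π') (d₂ : Sweep l₂ π π') (d₃ : Sweep l₃ π π')
    (e₂ : Sweep m₂ π π') (e₃ : Sweep m₃ π π') (d : Sweep l π π') :
    (L.swap hAB U h₁ h₂ d₁ d₂).hom ≫ (L.swap hAC _ h₂' h₃' d₂ d₃).hom ≫
        (L.swap hBC U h₃ h d₃ d).hom =
      (L.swap hBC _ h₁' k₂' d₁ e₂).hom ≫ (L.swap hAC U k₂ k₃ e₂ e₃).hom ≫
        (L.swap hAB _ k₃' h' e₃ d).hom := by
  induction U generalizing l₁ l₂ l₃ m₂ m₃ l π with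
  | nil =>
    subst h₁ h₂ h₃ k₂ k₃ h
    obtain _ | ⟨A₀, _ | ⟨B₁, _ | ⟨C₃, r₁⟩⟩⟩ := d₁
    obtain _ | ⟨B₀, _ | ⟨A₁, _ | ⟨C₃', r₂⟩⟩⟩ := d₂
    obtain _ | ⟨B₀', _ | ⟨C₂, _ | ⟨A₃, r₃⟩⟩⟩ := d₃
    obtain _ | ⟨A₀', _ | ⟨C₁, _ | ⟨B₃, r₄⟩⟩⟩ := e₂
    obtain _ | ⟨C₀, _ | ⟨A₂, _ | ⟨B₃', r₅⟩⟩⟩ := e₃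
    obtain _ | ⟨C₀', _ | ⟨B₂, _ | ⟨A₃', r₆⟩⟩⟩ := d
    obtain rfl := A₀.target_eq A₀'
    obtain rfl := Subsingleton.elim A₀ A₀'
    obtain rfl := B₀.target_eq B₀'
    obtain rfl := Subsingleton.elim B₀ B₀'
    obtain rfl := C₀.target_eq C₀'
    obtain rfl := Subsingleton.elim C₀ C₀'
    obtain rfl := corner hAB A₀ B₀ B₁ A₁
    obtain rfl := corner hAC A₀ C₀ C₁ A₂
    obtain rfl := corner hBC B₀ C₀ C₂ B₂
    obtain rfl := C₃.target_eq C₃'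
    obtain rfl := Subsingleton.elim C₃ C₃'
    obtain rfl := B₃.target_eq B₃'
    obtain rfl := Subsingleton.elim B₃ B₃'
    obtain rfl := A₃.target_eq A₃'
    obtain rfl := Subsingleton.elim A₃ A₃'
    obtain rfl := corner hAC A₁ C₂ C₃ A₃
    obtain rfl := corner hBC B₁ C₁ C₃ B₃
    obtain rfl := Subsingleton.elim r₁ r₂
    obtain rfl := Subsingleton.elim r₁ r₃
    obtain rfl := Subsingleton.elim r₁ r₄
    obtain rfl := Subsingleton.elim r₁ r₅
    obtain rfl := Subsingleton.elim r₁ r₆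
    have key := L.hex hAB hAC hBC A₀ A₁ A₂ A₃ B₀ B₁ B₂ B₃ C₀ C₁ C₂ C₃
    rw [Hex] at key
    change ((α_ _ _ _).inv ≫ (L.sq hAB A₀ B₁ B₀ A₁).hom ▷ (L.step C₃ ≫ L.comp r₁) ≫
          (α_ _ _ _).hom) ≫
        (L.step B₀ ◁ ((α_ _ _ _).inv ≫ (L.sq hAC A₁ C₃ C₂ A₃).hom ▷ (L.comp r₁) ≫
          (α_ _ _ _).hom)) ≫
        ((α_ _ _ _).inv ≫ (L.sq hBC B₀ C₂ C₀ B₂).hom ▷ (L.step A₃ ≫ L.comp r₁) ≫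
          (α_ _ _ _).hom) =
      (L.step A₀ ◁ ((α_ _ _ _).inv ≫ (L.sq hBC B₁ C₃ C₁ B₃).hom ▷ (L.comp r₁) ≫
          (α_ _ _ _).hom)) ≫
        ((α_ _ _ _).inv ≫ (L.sq hAC A₀ C₁ C₀ A₂).hom ▷ (L.step B₃ ≫ L.comp r₁) ≫
          (α_ _ _ _).hom) ≫
        (L.step C₀ ◁ ((α_ _ _ _).inv ≫ (L.sq hAB A₂ B₃ B₂ A₃).hom ▷ (L.comp r₁) ≫
          (α_ _ _ _).hom))
    generalize (L.sq hAB A₀ B₁ B₀ A₁).hom = x at *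
    generalize (L.sq hAC A₁ C₃ C₂ A₃).hom = y at *
    generalize (L.sq hBC B₀ C₂ C₀ B₂).hom = z at *
    generalize (L.sq hBC B₁ C₃ C₁ B₃).hom = z' at *
    generalize (L.sq hAC A₀ C₁ C₀ A₂).hom = y' at *
    generalize (L.sq hAB A₂ B₃ B₂ A₃).hom = x' at *
    generalize L.step A₀ = a₀ at *
    generalize L.step A₁ = a₁ at *
    generalize L.step A₂ = a₂ at *
    generalize L.step A₃ = a₃ at *
    generalize L.step B₀ = b₀ at *
    generalize L.step B₁ = b₁ at *
    generalize L.step B₂ = b₂ at *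
    generalize L.step B₃ = b₃ at *
    generalize L.step C₀ = c₀ at *
    generalize L.step C₁ = c₁ at *
    generalize L.step C₂ = c₂ at *
    generalize L.step C₃ = c₃ at *
    generalize L.comp r₁ = r at *
    exact hex_whisker key r
  | cons X U ih =>
    subst h₁ h₂ h₃ k₂ k₃ h
    obtain _ | ⟨o, d₁⟩ := d₁
    obtain _ | ⟨o₂, d₂⟩ := d₂
    obtain _ | ⟨o₃, d₃⟩ := d₃
    obtain _ | ⟨o₄, e₂⟩ := e₂
    obtain _ | ⟨o₅, e₃⟩ := e₃
    obtain _ | ⟨o₆, d⟩ := d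
    obtain rfl := o.target_eq o₂
    obtain rfl := o.target_eq o₃
    obtain rfl := o.target_eq o₄
    obtain rfl := o.target_eq o₅
    obtain rfl := o.target_eq o₆
    obtain rfl := Subsingleton.elim o o₂
    obtain rfl := Subsingleton.elim o o₃
    obtain rfl := Subsingleton.elim o o₄
    obtain rfl := Subsingleton.elim o o₅
    obtain rfl := Subsingleton.elim o o₆
    have j₁ := (List.cons.inj h₁').2
    have j₂ := (List.cons.inj h₂').2
    have j₃ := (List.cons.inj h₃').2
    have i₂ := (List.cons.inj k₂').2
    have i₃ := (List.cons.inj k₃').2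
    have j := (List.cons.inj h').2
    have := ih rfl rfl rfl rfl rfl rfl j₂ j₃ j₁ i₂ i₃ j d₁ d₂ d₃ e₂ e₃ d
    have f₁ := congrArg Iso.hom (L.swap_cons hAB rfl rfl rfl rfl o d₁ d₂)
    have f₂ := congrArg Iso.hom (L.swap_cons hAC j₂ j₃ h₂' h₃' o d₂ d₃)
    have f₃ := congrArg Iso.hom (L.swap_cons hBC rfl rfl rfl rfl o d₃ d)
    have g₁ := congrArg Iso.hom (L.swap_cons hBC j₁ i₂ h₁' k₂' o d₁ e₂)
    have g₂ := congrArg Iso.hom (L.swap_cons hAC rfl rfl rfl rfl o e₂ e₃)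
    have g₃ := congrArg Iso.hom (L.swap_cons hAB i₃ j k₃' h' o e₃ d)
    refine (congrArg₂ (· ≫ ·) f₁ (congrArg₂ (· ≫ ·) f₂ f₃)).trans
      (Eq.trans ?_ (congrArg₂ (· ≫ ·) g₁ (congrArg₂ (· ≫ ·) g₂ g₃)).symm)
    change L.step o ◁ _ ≫ L.step o ◁ _ ≫ L.step o ◁ _ =
      L.step o ◁ _ ≫ L.step o ◁ _ ≫ L.step o ◁ _
    simp only [← Bicategory.whiskerLeft_comp]
    exact congrArg _ this

/-- A choice of the (unique) way in which the faces are applied in a given order. -/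
noncomputable def sweep (x : G.Order) : Sweep x.list G.top G.bot := (exists_sweep x.list x.isOrder).some

/-- The functor from the free category of orders given by a labelling. -/
noncomputable def freeFunctor : Paths G.Order ⥤ (L.path G.top ⟶ L.path G.bot) :=
  Paths.lift
    { obj := fun x => L.comp (sweep x)
      map := fun {x y} (e : Swap x y) =>
        (L.swap (Order.ne e.eq_source) e.U e.eq_source e.eq_target (sweep x) (sweep y)).hom }

theorem freeFunctor_gen {x y : G.Order} (e : Swap x y) : L.freeFunctor.map (gen e) =
    (L.swap (Order.ne e.eq_source) e.U e.eq_source e.eq_target (sweep x) (sweep y)).hom :=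
  Paths.lift_toPath _ _

/-- The functor given by a labelling. It sends an order of composition to the composite of the
labels of the faces in this order, and `U F H V ⟶ U H F V` to the interchange isomorphism of
the labels of `F` and `H` (or its inverse, if `H` lies further back than `F`), whiskered by the
labels of `U` and `V`. -/
noncomputable def functor : Orders G ⥤ (L.path G.top ⟶ L.path G.bot) :=
  CategoryTheory.Quotient.lift _ L.freeFunctor (by
    intro x y f g h
    cases h with
    | invol U V F H hx hy =>
      simp only [Functor.map_comp, freeFunctor_gen]
      rw [L.swap_symm]
      exact Iso.hom_inv_id _
    | comm U V W F H I J hx hy hz hw =>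
      simp only [Functor.map_comp, freeFunctor_gen]
      exact L.swap_comm _ _ U V W hx hy hz hw _ _ _ _ _ _ _ _
    | hexagon U V A B C h₁ h₂ h₃ k₂ k₃ h =>
      simp only [Functor.map_comp, freeFunctor_gen]
      exact L.swap_hexagon _ _ _ U V h₁ h₂ h₃ k₂ k₃ h _ _ _ _ _ _ _ _ _ _ _ _)

open Classical in
/-- The labelling which has `α'` in the face `F` and coincides with `L` everywhere else. -/
noncomputable def relabel (F : G.IntFace) (α' : L.path (upper F) ⟶ L.path (lower F)) :
    Labelling G K where
  cells := L.cells
  face := Function.update L.face F α'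

end Labelling

/-! Every morphism of `Orders G` is a composite of exchanges of two neighbouring faces. Naturality
therefore only has to be tested on a single exchange, and the relations between exchanges play no
part in it. What remains is bookkeeping: `F` may be one of the two exchanged faces, or lie before
them in the list, or after them.

The case distinction disappears in a more symmetric statement. Take a 3-cell from the label of `H`
to a new label `f H` for every face `H` at once. For each order of composition, the horizontal
composite of these 3-cells, whiskered and taken in that order (`compMap`), is the component of a
natural transformation (`natTrans`). The theorem is the case in which all 3-cells except the one at
`F` are identities.

Naturality of the general family at an exchange of `F` and `H` has three layers. If `F` lies earlier
along the path than `H`, the path is cut just behind `F`, and the comparison is the interchange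
isomorphism `γ` of one 2-cell on each side of the cut. The square is then naturality of `γ` in both
variables (`γ_natural`, `stepMap_sqAux`). If `H` lies earlier, the comparison is the inverse of such
a `γ`, and the square is read backwards (`stepMap_sq`). The faces applied after the exchange are
added by `whisker_square`, those applied before it by an induction in `compMap_swap`. Both of these
rest on the exchange law for whiskering, because the extra 3-cells act on a different factor from
the comparison.

Finally, when all 3-cells off `F` are identities, the horizontal composite collapses to the 3-cell
at `F`, whiskered by what comes before and after (`compMap_heq_whisker`). The hom 2-categories are
strict, but their 1-morphisms, and composites along decomposed paths, are equal only
propositionally. Hence most comparisons are heterogeneous equalities, removed by turning the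
boundaries into variables and substituting. -/

/-! ### Whiskering in bicategories, and its strict simplifications. -/

section Strict

variable {B : Type*} [Bicategory B]

/-- This passes from two exchanged faces to two exchanged faces followed by a tail. The 2-morphism
`T` of the tail commutes with `θ'` because they act on different factors. Once it is out of the way,
the hypothesis applies, whiskered by `t`. The shape matches the unfolded `compMap` and `swapHead`.
-/
theorem whisker_square {a b c d e : B} {p p' : a ⟶ b} {q q' : b ⟶ d} {r r' : a ⟶ c}
    {s s' : c ⟶ d} {P : p ⟶ p'} {Q : q ⟶ q'} {R : r ⟶ r'} {S : s ⟶ s'} {θ : p ≫ q ⟶ r ≫ s}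
    {θ' : p' ≫ q' ⟶ r' ≫ s'} (h : (P ▷ q ≫ p' ◁ Q) ≫ θ' = θ ≫ R ▷ s ≫ r' ◁ S)
    {t t' : d ⟶ e} (T : t ⟶ t') :
    (P ▷ (q ≫ t) ≫ p' ◁ (Q ▷ t ≫ q' ◁ T)) ≫ (α_ _ _ _).inv ≫ θ' ▷ t' ≫ (α_ _ _ _).hom =
      ((α_ _ _ _).inv ≫ θ ▷ t ≫ (α_ _ _ _).hom) ≫ R ▷ (s ≫ t) ≫ r' ◁ (S ▷ t ≫ s' ◁ T) := by
  calc _ = (α_ _ _ _).inv ≫ ((P ▷ q ≫ p' ◁ Q) ▷ t ≫ (p' ≫ q') ◁ T ≫ θ' ▷ t') ≫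
        (α_ _ _ _).hom := by
        simp
    _ = (α_ _ _ _).inv ≫ (((P ▷ q ≫ p' ◁ Q) ≫ θ') ▷ t ≫ (r' ≫ s') ◁ T) ≫ (α_ _ _ _).hom := by
        -- The tail's `T` moves behind `θ'`, so that `θ'` stands next to `P` and `Q`, as in `h`.
        rw [whisker_exchange, comp_whiskerRight _ θ']
        simp only [Category.assoc]
    _ = _ := by
        rw [h]
        simp

variable [Bicategory.Strict B]

/-- In a strict bicategory the unitors and associators are `eqToHom`s. So this whiskering, like
those below, changes the type of a 2-morphism but not the 2-morphism itself. -/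
theorem id_whiskerLeft_heq {a b : B} {x y : a ⟶ b} (θ : x ⟶ y) : 𝟙 a ◁ θ ≍ θ := by
  simp [Bicategory.Strict.leftUnitor_eqToIso]

theorem whiskerRight_id_heq {a b : B} {x y : a ⟶ b} (θ : x ⟶ y) : θ ▷ 𝟙 b ≍ θ := by
  simp [Bicategory.Strict.rightUnitor_eqToIso]

theorem comp_whiskerLeft_heq {a b c d : B} (p : a ⟶ b) (q : b ⟶ c) {x y : c ⟶ d} (θ : x ⟶ y) :
    (p ≫ q) ◁ θ ≍ p ◁ q ◁ θ := by
  simp [Bicategory.Strict.associator_eqToIso]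

/-- Together with its mirror image, this strips off the transports by which `whisk₃` is defined. -/
theorem eqToHom_whiskerLeft_heq {a b c : B} (h : a = b) {x y : b ⟶ c} (θ : x ⟶ y) :
    eqToHom h ◁ θ ≍ θ := by
  subst h
  exact id_whiskerLeft_heq θ

theorem whiskerRight_eqToHom_heq {a b c : B} (h : b = c) {x y : a ⟶ b} (θ : x ⟶ y) :
    θ ▷ eqToHom h ≍ θ := by
  subst h
  exact whiskerRight_id_heq θ

end Strict

/-! ### Naturality of the interchange isomorphism in both variables. -/

namespace GrayCategory

variable {K : Type*} [GrayCategory K]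

/-- Naturality in the second variable carries `Θ` across, then naturality in the first carries `Γ`
across. They arrive in the opposite order, which the exchange law corrects. -/
theorem γ_natural {X Y Z : K} {f f' : X ⟶ Y} {α α' : f ⟶ f'} (Γ : α ⟶ α') {g g' : Y ⟶ Z}
    {β β' : g ⟶ g'} (Θ : β ⟶ β') :
    (wr₃ Γ g ▷ wl f' β ≫ wr α' g ◁ wl₃ f' Θ) ≫ (γ α' β').hom =
      (γ α β).hom ≫ wl₃ f Θ ▷ wr α g' ≫ wl f β' ◁ wr₃ Γ g' := by
  rw [Category.assoc, γ_natural_right, ← Category.assoc, γ_natural_left, Category.assoc,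
    whisker_exchange]

/-- The steps of a sweep run between labels of whole paths, which equal the composites in the
boundary of `γ` only propositionally. Here every cell of the square is a variable, so that all these
identifications can be eliminated at once. -/
theorem γ_natural_of_heq {X Y Z : K} {f f' : X ⟶ Y} {α α' : f ⟶ f'} (Γ : α ⟶ α') {g g' : Y ⟶ Z}
    {β β' : g ⟶ g'} (Θ : β ⟶ β') {p q r s : X ⟶ Z} (hp : p = f ≫ g) (hq : q = f' ≫ g)
    (hr : r = f ≫ g') (hs : s = f' ≫ g') {x x' : p ⟶ q} (hx : x ≍ wr α g) (hx' : x' ≍ wr α' g)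
    {y y' : q ⟶ s} (hy : y ≍ wl f' β) (hy' : y' ≍ wl f' β') {z z' : p ⟶ r} (hz : z ≍ wl f β)
    (hz' : z' ≍ wl f β') {w w' : r ⟶ s} (hw : w ≍ wr α g') (hw' : w' ≍ wr α' g')
    {X : x ⟶ x'} (hX : X ≍ wr₃ Γ g) {Y : y ⟶ y'} (hY : Y ≍ wl₃ f' Θ)
    {Z : z ⟶ z'} (hZ : Z ≍ wl₃ f Θ) {W : w ⟶ w'} (hW : W ≍ wr₃ Γ g')
    {c : x ≫ y ⟶ z ≫ w} (hc : c ≍ (γ α β).hom) {c' : x' ≫ y' ⟶ z' ≫ w'}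
    (hc' : c' ≍ (γ α' β').hom) :
    (X ▷ y ≫ x' ◁ Y) ≫ c' = c ≫ Z ▷ w ≫ z' ◁ W := by
  subst hp hq hr hs
  cases hx; cases hx'; cases hy; cases hy'; cases hz; cases hz'; cases hw; cases hw'
  cases hX; cases hY; cases hZ; cases hW; cases hc; cases hc'
  exact γ_natural Γ Θ

end GrayCategory

/-! ### Whiskered 3-cells of a face. -/

namespace Labelling

variable {G : PastingScheme.{u}} {K : Type*} [GrayCategory K] (L : Labelling G K)

theorem whisk₃_heq {a b : G.Vertex} {F : G.IntFace} {π ρ : G.DPath a b} (o : Occ F π ρ)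
    {x : G.DPath a (fs F)} {y : G.DPath (ft F) b} (hx : o.pre = x) (hy : o.post = y)
    {β β' : L.path (upper F) ⟶ L.path (lower F)} (Γ : β ⟶ β') :
    L.whisk₃ o Γ ≍ wl₃ (L.path x) (wr₃ Γ (L.path y)) := by
  subst hx hy
  have h₁ := (congrArg L.path o.eq_upper).trans (L.path_comp₃ _ _ _)
  have h₂ := (congrArg L.path o.eq_lower).trans (L.path_comp₃ _ _ _)
  exact (eqToHom_whiskerLeft_heq h₁ _).trans (whiskerRight_eqToHom_heq h₂.symm _)

/-- This bracketing, with the target-side whiskering outermost, is the one needed for the face in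
the first variable of `γ`. -/
theorem whisk₃_heq_wr₃ {a b : G.Vertex} {F : G.IntFace} {π ρ : G.DPath a b} (o : Occ F π ρ)
    {x : G.DPath a (fs F)} {y : G.DPath (ft F) b} (hx : o.pre = x) (hy : o.post = y)
    {β β' : L.path (upper F) ⟶ L.path (lower F)} (Γ : β ⟶ β') :
    L.whisk₃ o Γ ≍ wr₃ (wl₃ (L.path x) Γ) (L.path y) :=
  (L.whisk₃_heq o hx hy Γ).trans (wr₃_wl₃ _ _ _).symm

theorem whisk₃_id {a b : G.Vertex} {F : G.IntFace} {π ρ : G.DPath a b} (o : Occ F π ρ)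
    (β : L.path (upper F) ⟶ L.path (lower F)) : L.whisk₃ o (𝟙 β) = 𝟙 (L.whisk o β) := by
  simp [whisk₃, whisk, wr₃_id, wl₃_id]

/-- The labelling with the same cells on vertices and edges and with given labels of the faces. -/
abbrev withFaces (f : ∀ H : G.IntFace, L.path (upper H) ⟶ L.path (lower H)) : Labelling G K :=
  ⟨L.cells, f⟩

/-! ### Families of 3-cells, one for each face, and their compatibility with interchange. -/

variable {f : ∀ H : G.IntFace, L.path (upper H) ⟶ L.path (lower H)}
  (Γ : ∀ H : G.IntFace, L.face H ⟶ f H)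

/-- The 3-cell of a face, whiskered by the labels of the rest of a path through the face. -/
noncomputable def stepMap {a b : G.Vertex} {F : G.IntFace} {π ρ : G.DPath a b} (o : Occ F π ρ) :
    L.step o ⟶ (L.withFaces f).step o :=
  -- The type is right by definition: both labellings have the same cells on vertices and edges, so
  -- their whiskerings coincide.
  L.whisk₃ o (Γ F)

/-- The horizontal composite of the 3-cells of the faces of a list. -/
noncomputable def compMap {l : List G.IntFace} {π π' : G.DPath G.s G.t} :
    (d : Sweep l π π') → (L.comp d ⟶ (L.withFaces f).comp d)
  | .nil _ => 𝟙 _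
  | .cons o d => L.stepMap Γ o ▷ L.comp d ≫ (L.withFaces f).step o ◁ compMap d

/-- The path is cut just after `F`. The label of `F` whiskered by the initial part is the first
argument of `γ`. The label of `H`, whiskered by the middle and the final part, is the second. The
square is naturality of `γ` at the two 3-cells whiskered in the same way. -/
theorem stepMap_sqAux {a b : G.Vertex} {F H : G.IntFace} {π π₁ π₂ ρ : G.DPath a b}
    {o : Occ F π π₁} {o₁' : Occ H π₁ ρ} {o' : Occ H π π₂} {o₁ : Occ F π₂ ρ} (z : Between o o') :
    (L.stepMap Γ o ▷ L.step o₁' ≫ (L.withFaces f).step o ◁ L.stepMap Γ o₁') ≫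
        ((L.withFaces f).sqAux z (o₁' := o₁') (o₁ := o₁)).hom =
      (L.sqAux z (o₁' := o₁') (o₁ := o₁)).hom ≫
        L.stepMap Γ o' ▷ L.step o₁ ≫ (L.withFaces f).step o' ◁ L.stepMap Γ o₁ := by
  have h₀ := (congrArg L.path z.eq_source).trans (L.path_comp₅ _ _ _ _ _)
  have h₁ := (congrArg L.path z.eq_left).trans (L.path_comp₅ _ _ _ _ _)
  have h₂ := (congrArg L.path z.eq_right).trans (L.path_comp₅ _ _ _ _ _)
  have h₃ := (congrArg L.path (z.eq_target o₁')).trans (L.path_comp₅ _ _ _ _ _)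
  have hu : L.path o.pre ≫ L.path (upper F) ≫ L.path z.mid = L.path o'.pre := by
    rw [z.pre_eq, path_comp₃]
  have hl : L.path o.pre ≫ L.path (lower F) ≫ L.path z.mid = L.path o₁'.pre := by
    rw [(z.second o₁').1, path_comp₃]
  refine γ_natural_of_heq (wl₃ (L.path o.pre) (Γ F))
    (wl₃ (L.path z.mid) (wr₃ (Γ H) (L.path o'.post))) h₀ h₁ h₂ h₃
    (L.step_left_heq o o' z) ((L.withFaces f).step_left_heq o o' z)
    (L.step_second_heq o₁' z) ((L.withFaces f).step_second_heq o₁' z)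
    (L.step_right_heq o o' z) ((L.withFaces f).step_right_heq o o' z)
    (L.step_first_heq o₁ z) ((L.withFaces f).step_first_heq o₁ z) ?_ ?_ ?_ ?_
    (L.sqAux_heq z) ((L.withFaces f).sqAux_heq z)
  -- The four goals are the 3-cells of the sides: `F` before `H`, `H` after `F`, `H` before `F`, `F`
  -- after `H`. For `F`, the part beyond the cut is whiskered on outermost. For `H`, it is the part
  -- up to the cut, which runs along the upper or the lower path of `F` according to whether `F` is
  -- still to come.
  · rw [← path_comp₃]
    exact L.whisk₃_heq_wr₃ o rfl z.post_eq _
  · refine (L.whisk₃_heq o₁' (z.second o₁').1 (z.second o₁').2 _).trans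
      (HEq.trans ?_ (comp_wl₃ _ _ _))
    exact wl₃_heq ((L.path_comp₃ _ _ _).trans (Category.assoc _ _ _).symm) rfl rfl HEq.rfl HEq.rfl
      HEq.rfl
  · refine (L.whisk₃_heq o' z.pre_eq rfl _).trans (HEq.trans ?_ (comp_wl₃ _ _ _))
    exact wl₃_heq ((L.path_comp₃ _ _ _).trans (Category.assoc _ _ _).symm) rfl rfl HEq.rfl HEq.rfl
      HEq.rfl
  · rw [← path_comp₃]
    exact L.whisk₃_heq_wr₃ o₁ (z.first o₁).1 (z.first o₁).2 _

/-- Either face may lie earlier along the path. In one case the comparison is `γ` itself, in the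
other its inverse, so both cases reduce to `stepMap_sqAux`. -/
theorem stepMap_sq {a b : G.Vertex} {F H : G.IntFace} (hFH : F ≠ H) {π π₁ π₂ ρ : G.DPath a b}
    (o : Occ F π π₁) (o₁' : Occ H π₁ ρ) (o' : Occ H π π₂) (o₁ : Occ F π₂ ρ) :
    (L.stepMap Γ o ▷ L.step o₁' ≫ (L.withFaces f).step o ◁ L.stepMap Γ o₁') ≫
        ((L.withFaces f).sq hFH o o₁' o' o₁).hom =
      (L.sq hFH o o₁' o' o₁).hom ≫
        L.stepMap Γ o' ▷ L.step o₁ ≫ (L.withFaces f).step o' ◁ L.stepMap Γ o₁ := by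
  rcases between_total hFH o o' with ⟨⟨z⟩⟩ | ⟨⟨z⟩⟩
  · rw [L.sq_eq hFH _ _ _ _ z, (L.withFaces f).sq_eq hFH _ _ _ _ z]
    exact L.stepMap_sqAux Γ z
  -- With `H` earlier along the path, moving the two inverse isomorphisms to the opposite sides
  -- leaves the square of `stepMap_sqAux` for `H` and `F`, read from right to left.
  · rw [← L.sq_symm hFH.symm, ← (L.withFaces f).sq_symm hFH.symm, L.sq_eq hFH.symm _ _ _ _ z,
      (L.withFaces f).sq_eq hFH.symm _ _ _ _ z, Iso.symm_hom, Iso.symm_hom, Iso.comp_inv_eq,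
      Category.assoc, Iso.eq_inv_comp]
    exact (L.stepMap_sqAux Γ z).symm

theorem compMap_swapHead {F H : G.IntFace} (hFH : F ≠ H) {V : List G.IntFace}
    {π π' : G.DPath G.s G.t} (d : Sweep (F :: H :: V) π π') (d' : Sweep (H :: F :: V) π π') :
    L.compMap Γ d ≫ ((L.withFaces f).swapHead hFH d d').hom =
      (L.swapHead hFH d d').hom ≫ L.compMap Γ d' := by
  obtain _ | ⟨o, _ | ⟨o₁', r⟩⟩ := d
  obtain _ | ⟨o', _ | ⟨o₁, r'⟩⟩ := d'
  -- Both orders of applying `F` and `H` reach the same path, and a sweep along a given list between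
  -- given paths is unique. So the two sweeps share their tail, as `whisker_square` requires.
  obtain rfl := corner hFH o o' o₁' o₁
  obtain rfl := Subsingleton.elim r r'
  have key := L.stepMap_sq Γ hFH o o₁' o' o₁
  change (L.stepMap Γ o ▷ (L.step o₁' ≫ L.comp r) ≫ (L.withFaces f).step o ◁
      (L.stepMap Γ o₁' ▷ L.comp r ≫ (L.withFaces f).step o₁' ◁ L.compMap Γ r)) ≫
      ((α_ _ _ _).inv ≫ ((L.withFaces f).sq hFH o o₁' o' o₁).hom ▷ (L.withFaces f).comp r ≫
        (α_ _ _ _).hom) =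
    ((α_ _ _ _).inv ≫ (L.sq hFH o o₁' o' o₁).hom ▷ L.comp r ≫ (α_ _ _ _).hom) ≫
      (L.stepMap Γ o' ▷ (L.step o₁ ≫ L.comp r) ≫ (L.withFaces f).step o' ◁
        (L.stepMap Γ o₁ ▷ L.comp r ≫ (L.withFaces f).step o₁ ◁ L.compMap Γ r))
  exact whisker_square key _

/-- Induction on the faces applied before the exchange. Such a face has the same occurrence in both
sweeps, and its 3-cell acts on a different factor from the exchange in the rest of the list. -/
theorem compMap_swap {F H : G.IntFace} (hFH : F ≠ H) {V : List G.IntFace} (U : List G.IntFace)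
    {l l' : List G.IntFace} (hl : l = U ++ F :: H :: V) (hl' : l' = U ++ H :: F :: V)
    {π π' : G.DPath G.s G.t} (d : Sweep l π π') (d' : Sweep l' π π') :
    L.compMap Γ d ≫ ((L.withFaces f).swap hFH U hl hl' d d').hom =
      (L.swap hFH U hl hl' d d').hom ≫ L.compMap Γ d' := by
  induction U generalizing l l' π with
  | nil =>
    subst hl hl'
    exact L.compMap_swapHead Γ hFH d d'
  | cons X U ih =>
    subst hl hl'
    cases d with
    | cons o d =>
    cases d' with
    | cons o' d' =>
    obtain rfl := o.target_eq o'
    obtain rfl := Subsingleton.elim o o'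
    have := ih rfl rfl d d'
    change (L.stepMap Γ o ▷ L.comp d ≫ (L.withFaces f).step o ◁ L.compMap Γ d) ≫
        (L.withFaces f).step o ◁ ((L.withFaces f).swap hFH U rfl rfl d d').hom =
      L.step o ◁ (L.swap hFH U rfl rfl d d').hom ≫
        L.stepMap Γ o ▷ L.comp d' ≫ (L.withFaces f).step o ◁ L.compMap Γ d'
    rw [Category.assoc, ← Bicategory.whiskerLeft_comp]
    refine (congrArg (fun s => L.stepMap Γ o ▷ L.comp d ≫ (L.withFaces f).step o ◁ s)
      this).trans ?_
    -- The exchange law moves the 3-cell of `X` past the comparison in the tail.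
    rw [whisker_exchange_assoc, ← Bicategory.whiskerLeft_comp]

/-- The natural transformation given by 3-cells for all faces. -/
noncomputable def natTrans : L.functor ⟶ (L.withFaces f).functor :=
  -- The quotient and the free category have the same objects, and naturality on the free category
  -- follows from naturality on the generating exchanges.
  Quotient.natTransLift _
    (Paths.liftNatTrans (F := L.freeFunctor) (G := (L.withFaces f).freeFunctor)
      (fun x => L.compMap Γ (sweep x)) fun {x y} e => by
        refine (congrArg (· ≫ _) (L.freeFunctor_gen e)).trans
          (Eq.trans ?_ (congrArg (_ ≫ ·) ((L.withFaces f).freeFunctor_gen e)).symm)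
        exact (L.compMap_swap Γ _ _ _ _ _ _).symm)

/-! ### Families which are the identity away from one face. -/

theorem stepMap_heq_id {a b : G.Vertex} {F : G.IntFace} (hf : f F = L.face F)
    (hΓ : Γ F ≍ 𝟙 (L.face F)) {π ρ : G.DPath a b} (o : Occ F π ρ) :
    L.stepMap Γ o ≍ 𝟙 (L.step o) := by
  rw [stepMap]
  change L.whisk₃ o (Γ F) ≍ 𝟙 (L.whisk o (L.face F))
  -- The 3-cell and its target must become variables before `hf` can be substituted.
  generalize Γ F = Θ at *
  generalize f F = φ at *
  subst hf
  cases hΓ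
  exact heq_of_eq (L.whisk₃_id o _)

theorem step_withFaces {a b : G.Vertex} {F : G.IntFace} (hf : f F = L.face F)
    {π ρ : G.DPath a b} (o : Occ F π ρ) : (L.withFaces f).step o = L.step o :=
  congrArg (L.whisk o) hf

/-- The two conclusions are proved together: the heterogeneous equality for the tail can be used
only after the composites that bound it have been identified. -/
theorem compMap_heq_id {l : List G.IntFace} (hf : ∀ H ∈ l, f H = L.face H)
    (hΓ : ∀ H ∈ l, Γ H ≍ 𝟙 (L.face H)) {π π' : G.DPath G.s G.t} (d : Sweep l π π') :
    (L.withFaces f).comp d = L.comp d ∧ L.compMap Γ d ≍ 𝟙 (L.comp d) := by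
  induction d with
  | nil => exact ⟨rfl, HEq.rfl⟩
  | @cons F l π ρ π' o d ih =>
    obtain ⟨ih₁, ih₂⟩ := ih (fun H h => hf H (.tail _ h)) fun H h => hΓ H (.tail _ h)
    have h₁ := L.step_withFaces (hf F (.head _)) o
    have h₂ := L.stepMap_heq_id Γ (hf F (.head _)) (hΓ F (.head _)) o
    change (L.withFaces f).step o ≫ (L.withFaces f).comp d = L.step o ≫ L.comp d ∧
      L.stepMap Γ o ▷ L.comp d ≫ (L.withFaces f).step o ◁ L.compMap Γ d ≍
        𝟙 (L.step o ≫ L.comp d)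
    generalize L.compMap Γ d = t at *
    generalize L.stepMap Γ o = s at *
    generalize (L.withFaces f).comp d = c at *
    generalize (L.withFaces f).step o = p at *
    subst ih₁ h₁
    cases ih₂; cases h₂
    simp

/-- A horizontal composite in which all factors but one are identities is the whiskering of that
factor. The faces of `V` are absorbed by `compMap_heq_id`, those of `U` one at a time by induction.
The two equations between composites serve the induction, since they identify the boundaries of the
heterogeneous equality. -/
theorem compMap_heq_whisker {F : G.IntFace} {U V : List G.IntFace}
    (hf : ∀ H, H ∈ U ∨ H ∈ V → f H = L.face H)
    (hΓ : ∀ H, H ∈ U ∨ H ∈ V → Γ H ≍ 𝟙 (L.face H)) {l : List G.IntFace} (hl : l = U ++ F :: V)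
    {π π' : G.DPath G.s G.t} (c : Sweep l π π') :
    ∃ (σ ρ : G.DPath G.s G.t) (d : Sweep U π σ) (o : Occ F σ ρ) (e : Sweep V ρ π'),
      L.comp c = L.comp d ≫ L.step o ≫ L.comp e ∧
      (L.withFaces f).comp c = L.comp d ≫ (L.withFaces f).step o ≫ L.comp e ∧
      L.compMap Γ c ≍ L.comp d ◁ L.stepMap Γ o ▷ L.comp e := by
  induction U generalizing l π with
  | nil =>
    subst hl
    obtain _ | ⟨o, e⟩ := c
    obtain ⟨h₁, h₂⟩ := L.compMap_heq_id Γ (fun H h => hf H (.inr h)) (fun H h => hΓ H (.inr h)) e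
    -- With nothing before `F`, the left whiskering is by the empty composite, an identity that
    -- strictness removes.
    refine ⟨_, _, .nil _, o, e, (Strict.id_comp _).symm, ?_, ?_⟩
    · refine Eq.trans ?_ (Strict.id_comp _).symm
      exact congrArg _ h₁
    · refine HEq.trans ?_ (id_whiskerLeft_heq _).symm
      change L.stepMap Γ o ▷ L.comp e ≫ (L.withFaces f).step o ◁ L.compMap Γ e ≍ _
      generalize L.compMap Γ e = t at *
      generalize (L.withFaces f).comp e = c at *
      subst h₁
      cases h₂
      simp
  | cons X U ih =>
    subst hl
    obtain _ | ⟨q, c⟩ := c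
    obtain ⟨σ, ρ, d, o, e, h₁, h₂, h₃⟩ := ih
      (fun H h => hf H (h.imp_left (.tail _))) (fun H h => hΓ H (h.imp_left (.tail _))) rfl c
    have k₁ := L.step_withFaces (hf X (.inl (.head _))) q
    have k₂ := L.stepMap_heq_id Γ (hf X (.inl (.head _))) (hΓ X (.inl (.head _))) q
    refine ⟨σ, ρ, .cons q d, o, e, ?_, ?_, ?_⟩
    · exact (congrArg (L.step q ≫ ·) h₁).trans (Strict.assoc _ _ _).symm
    · exact (congrArg₂ (· ≫ ·) k₁ h₂).trans (Strict.assoc _ _ _).symm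
    -- Whiskering by the composite of `X` and the remaining prefix is whiskering twice; the inner
    -- one is the induction hypothesis, and the 3-cell of `X` is an identity.
    · refine HEq.trans ?_ (comp_whiskerLeft_heq _ _ _).symm
      change L.stepMap Γ q ▷ L.comp c ≫ (L.withFaces f).step q ◁ L.compMap Γ c ≍
        L.step q ◁ L.comp d ◁ L.stepMap Γ o ▷ L.comp e
      generalize L.compMap Γ c = t at *
      generalize L.stepMap Γ q = s at *
      generalize (L.withFaces f).comp c = c' at *
      generalize (L.withFaces f).step q = p at *
      generalize L.comp c = c at *
      subst k₁ h₁ h₂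
      cases h₃; cases k₂
      simp

/-! ### A 3-cell in a single face. -/

open Classical in
/-- A 3-cell of the face `F`, together with the identity 3-cells of the other faces. -/
noncomputable def extendMap (F : G.IntFace) {α' : L.path (upper F) ⟶ L.path (lower F)}
    (Γ : L.face F ⟶ α') (H : G.IntFace) : L.face H ⟶ Function.update L.face F α' H :=
  if h : H = F then by
    subst h
    exact Γ ≫ eqToHom (by rw [Function.update_self])
  else eqToHom (Function.update_of_ne h _ _).symm

theorem extendMap_self (F : G.IntFace) {α' : L.path (upper F) ⟶ L.path (lower F)}
    (Γ : L.face F ⟶ α') : L.extendMap F Γ F ≍ Γ := by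
  rw [extendMap, dif_pos rfl]
  exact comp_eqToHom_heq _ _

theorem extendMap_of_ne {F H : G.IntFace} (h : H ≠ F)
    {α' : L.path (upper F) ⟶ L.path (lower F)} (Γ : L.face F ⟶ α') :
    L.extendMap F Γ H ≍ 𝟙 (L.face H) := by
  rw [extendMap, dif_neg h]
  exact eqToHom_heq_id_dom _ _ _

/-- The updated labelling takes the value `α'` at `F` only up to a propositional equality. With both
targets as variables, this equality can be substituted. -/
theorem whiskerLeft_whisk₃_whiskerRight_heq {F : G.IntFace} {π σ ρ π' : G.DPath G.s G.t}
    (p : L.path π ⟶ L.path σ) (o : Occ F σ ρ) (q : L.path ρ ⟶ L.path π')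
    {β β₁ β₂ : L.path (upper F) ⟶ L.path (lower F)} (h : β₁ = β₂) {Γ₁ : β ⟶ β₁} {Γ₂ : β ⟶ β₂}
    (hΓ : Γ₁ ≍ Γ₂) : p ◁ L.whisk₃ o Γ₁ ▷ q ≍ p ◁ L.whisk₃ o Γ₂ ▷ q := by
  subst h; cases hΓ; rfl

end Labelling

theorem mainTheorem1 {K : Type*} [GrayCategory K] (G : PastingScheme.{u}) (L : Labelling G K)
    (F : G.IntFace) (α' : L.path (upper F) ⟶ L.path (lower F)) (Γ : L.face F ⟶ α') :
    ∃ Γs : L.functor ⟶ (L.relabel F α').functor, ∀ x : G.Order,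
      ∃ (U V : List G.IntFace) (π ρ : G.DPath G.s G.t)
        (d : Sweep U G.top π) (o : Occ F π ρ) (e : Sweep V ρ G.bot),
        x.list = U ++ F :: V ∧
          Γs.app x.toOrders ≍ L.comp d ◁ L.whisk₃ o Γ ▷ L.comp e := by
  classical
  -- By definition `relabel` is `withFaces` of the updated family of labels, so the general
  -- transformation already has the required target.
  refine ⟨L.natTrans (L.extendMap F Γ), fun x => ?_⟩
  obtain ⟨U, V, hx⟩ := List.append_of_mem (x.isOrder.mem F)
  -- Each face occurs only once in an order, so the family is the identity on all of `U` and `V`.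
  have hne : ∀ H, H ∈ U ∨ H ∈ V → H ≠ F := by
    have nd := x.isOrder.nodup
    rw [hx, List.nodup_middle, List.nodup_cons, List.mem_append] at nd
    rintro H h rfl
    exact nd.1 h
  obtain ⟨π, ρ, d, o, e, -, -, h⟩ := L.compMap_heq_whisker (L.extendMap F Γ)
    (fun H h => Function.update_of_ne (hne H h) _ _)
    (fun H h => L.extendMap_of_ne (hne H h) Γ) hx (Labelling.sweep x)
  -- The component at `x` unfolds to `compMap` along the chosen sweep, which `h` has computed. It
  -- remains to replace the value of the extended family at `F` by `Γ`.
  refine ⟨U, V, π, ρ, d, o, e, hx, h.trans ?_⟩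
  have hα : Function.update L.face F α' F = α' := Function.update_self F α' L.face
  exact L.whiskerLeft_whisk₃_whiskerRight_heq (L.comp d) o (L.comp e) hα
    (Γ₁ := L.extendMap F Γ F) (L.extendMap_self F Γ)
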